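/- Let $d\geq 1$ and let $\Omega\subset\mathbb{R}^d$ be a bounded connected open non-empty set with Lipschitz boundary. Let $a\in L_1(\mathbb{R}^d)$ be a non-negative function for which there are a constant $c_0>0$ and a ball $B_0$ of positive radius centred at $0$ such that $a\geq c_0$ a.e. in $B_0$. Let $1<p_-\leq p_+$ and let $\varphi=\varphi(t,x,y)\geq 0$, $t\geq 0$, $x,y\in\Omega$, be such that: (C1) for each complex-valued $u\in L_{1,loc}(\Omega)$ the function $(x,y)\mapsto\varphi(|u(x)-u(y)|,x,y)$ is measurable on $\Omega\times\Omega$; (C2) for every $\varepsilon>0$ there is $\delta\in(0,1)$ such that for a.e. $(x,y)\in\Omega\times\Omega$ and all $s,t>0$ with $|s-t|\geq\varepsilon\max\{s,t\}$ one has $\varphi\big(\tfrac{s+t}{2},x,y\big)\leq(1-\delta)\tfrac{\varphi(s,x,y)+\varphi(t,x,y)}{2}$; (C3) there is $\beta\geq1$ such that for a.e. $(x,y)\in\Omega\times\Omega$ and all $0<s\leq t$ one has $\frac{\varphi(s,x,y)}{s^{p_-}}\leq\beta\frac{\varphi(t,x,y)}{t^{p_-}}$ and $\frac{\varphi(t,x,y)}{t^{p_+}}\leq\beta\frac{\varphi(s,x,y)}{s^{p_+}}$;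 (C4) there is $c_1>0$ such that for a.e. $(x,y)\in\Omega\times\Omega$ one has $c_1^{-1}\leq\varphi(1,x,y)\leq c_1$, $\varphi(0,x,y)=0$, and $\varphi(t,x,y)>0$ for all $t>0$. For complex-valued $u\in L_{1,loc}(\Omega)$ put $$F(u)=\int_{\Omega\times\Omega}\varphi(|u(x)-u(y)|,x,y)\,a(x-y)\,dx\,dy\in[0,\infty],\qquad |u|_{p,\Omega}=\inf\{\lambda>0:\ F(u/\lambda)\leq1\},$$ with $\inf\emptyset=+\infty$. Let $\mathcal{L}(\Omega)$ be the set of $u\in L_{p_-,loc}(\Omega)$ with $\|u\|_{\mathcal{L}(\Omega)}:=|u|_{p,\Omega}+\|u\|_{L_{p_-}(\Omega)}<\infty$. Let $\Lambda(\Omega)$ be the set of the cosets $\mathbf{U}$ of $L_{1,loc}(\Omega)$ modulo constant functions such that $|\mathbf{U}|_{p,\Omega}:=|u|_{p,\Omega}<\infty$ for $u\in\mathbf{U}$ (the value does not depend on $u\in\mathbf{U}$). Let $\langle u\rangle_\Omega=\frac{1}{\operatorname{mes}\Omega}\int_\Omega u(x)\,dx$ and $u_\perp=u-\langle u\rangle_\Omega$.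 Then $\mathcal{L}(\Omega)$ and $\Lambda(\Omega)$ are complex linear spaces, and the following holds. 1. $\Lambda(\Omega)$ is a Banach space with the norm $|\cdot|_{p,\Omega}$. 2. Each coset $\mathbf{U}\in\Lambda(\Omega)$ contains a unique representative $u$ that belongs to $L_{p_-}(\Omega)$ and satisfies $\langle u\rangle_\Omega=0$. 3. $\mathcal{L}(\Omega)=\Lambda(\Omega)\oplus\mathbb{C}$ in the following sense: each $u\in\mathcal{L}(\Omega)$ is $u=u_\perp+\langle u\rangle_\Omega$ with $\langle u_\perp\rangle_\Omega=0$, the coset generated by $u$ is in $\Lambda(\Omega)$ and contains $u_\perp$, and the map sending $u$ to the pair of its coset and $\langle u\rangle_\Omega$ is a linear bijection of $\mathcal{L}(\Omega)$ onto $\Lambda(\Omega)\times\mathbb{C}$. 4. There are positive constants $c_3,c_4$ such that for all $u\in\mathcal{L}(\Omega)$ $$c_3\big(|u_\perp|_{p,\Omega}+|\langle u\rangle_\Omega|\big)\leq\|u\|_{\mathcal{L}(\Omega)}\leq c_4\big(|u_\perp|_{p,\Omega}+|\langle u\rangle_\Omega|\big).$$ -/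

import Mathlib

open MeasureTheory Filter Topology
open scoped ENNReal NNReal

noncomputable section

namespace NonlocalOrlicz

/-- The Euclidean space `ℝ^d`. -/
abbrev Euc (d : ℕ) : Type := EuclideanSpace ℝ (Fin d)

/-- An open set `Ω` has a Lipschitz boundary: near each boundary point, in suitable orthonormal
coordinates, `Ω` is the part of space lying above the graph of a Lipschitz function. Here `e` is the
unit vector of the vertical axis, `inner ℝ e x` is the vertical coordinate of `x`, and
`x - inner ℝ e x • e` is the orthogonal projection of `x` to the horizontal hyperplane. -/
def HasLipschitzBoundary {d : ℕ} (Ω : Set (Euc d)) : Prop :=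
  ∀ x₀ ∈ frontier Ω, ∃ e : Euc d, ‖e‖ = 1 ∧ ∃ (K : ℝ≥0) (γ : Euc d → ℝ), LipschitzWith K γ ∧
    ∃ r > 0, ∀ x ∈ Metric.ball x₀ r, (x ∈ Ω ↔ γ (x - inner ℝ e x • e) < inner ℝ e x)

/-- The space `L_{p,loc}(Ω)` of complex-valued functions, identified when equal a.e. on `Ω`. -/
def LpLoc {d : ℕ} (Ω : Set (Euc d)) (p : ℝ≥0∞) :
    Submodule ℂ (Euc d →ₘ[volume.restrict Ω] ℂ) where
  carrier := {u | ∀ K : Set (Euc d), K ⊆ Ω → IsCompact K → MemLp u p (volume.restrict K)}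
  zero_mem' := fun K hK _ => by
    refine MemLp.ae_eq ?_ (MemLp.zero (p := p) (μ := volume.restrict K) (ε := ℂ))
    exact (AEEqFun.coeFn_zero.filter_mono (ae_mono (Measure.restrict_mono hK le_rfl))).symm
  add_mem' := fun {u v} hu hv K hK hc => by
    refine MemLp.ae_eq ?_ ((hu K hK hc).add (hv K hK hc))
    exact ((AEEqFun.coeFn_add u v).filter_mono (ae_mono (Measure.restrict_mono hK le_rfl))).symm
  smul_mem' := fun c u hu K hK hc => by
    refine MemLp.ae_eq ?_ ((hu K hK hc).const_smul c)
    exact ((AEEqFun.coeFn_smul c u).filter_mono (ae_mono (Measure.restrict_mono hK le_rfl))).symm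

/-- The space `L_{1,loc}(Ω)`, with its usual linear structure. -/
def L1Loc {d : ℕ} (Ω : Set (Euc d)) : Type := LpLoc Ω 1

instance {d : ℕ} (Ω : Set (Euc d)) : AddCommGroup (L1Loc Ω) :=
  inferInstanceAs (AddCommGroup (Submodule.toAddSubgroup (LpLoc Ω 1)))

instance {d : ℕ} (Ω : Set (Euc d)) : Module ℂ (L1Loc Ω) :=
  inferInstanceAs (Module ℂ (LpLoc Ω 1))

/-- The class modulo equality a.e. on `Ω` of an element of `L_{1,loc}(Ω)`. -/
def L1Loc.toAE {d : ℕ} {Ω : Set (Euc d)} (u : L1Loc Ω) : Euc d →ₘ[volume.restrict Ω] ℂ := u.1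

/-- An element of `L_{1,loc}(Ω)` is used as a function: a representative of its class. -/
instance {d : ℕ} (Ω : Set (Euc d)) : CoeFun (L1Loc Ω) (fun _ => Euc d → ℂ) := ⟨fun u => u.toAE⟩

/-- The constant function with value `c`, as an element of `L_{1,loc}(Ω)`; linear in `c`. -/
def constFun {d : ℕ} (Ω : Set (Euc d)) : ℂ →ₗ[ℂ] L1Loc Ω where
  toFun c := ⟨AEEqFun.const (Euc d) c, fun K hK hc => by
    have : IsFiniteMeasure (volume.restrict K) := ⟨by simpa using hc.measure_lt_top⟩
    refine MemLp.ae_eq ?_ (memLp_const (p := 1) (μ := volume.restrict K) c)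
    exact ((AEEqFun.coeFn_const (Euc d) c).filter_mono
      (ae_mono (Measure.restrict_mono hK le_rfl))).symm⟩
  map_add' _ _ := rfl
  map_smul' _ _ := rfl

/-- The space of cosets of `L_{1,loc}(Ω)` under the relation
`u ∼ v` if `u - v` is constant a.e. on `Ω`. -/
abbrev Coset {d : ℕ} (Ω : Set (Euc d)) : Type := L1Loc Ω ⧸ LinearMap.range (constFun Ω)

/-- The coset generated by `u`. -/
abbrev coset {d : ℕ} {Ω : Set (Euc d)} (u : L1Loc Ω) : Coset Ω := Submodule.Quotient.mk u

/-- The functional `F(u) = ∫_{Ω × Ω} φ(|u(x) - u(y)|, x, y) a(x - y) dx dy`, possibly `∞`. -/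
def energy {d : ℕ} (Ω : Set (Euc d)) (a : Euc d → ℝ) (φ : ℝ → Euc d → Euc d → ℝ)
    (u : Euc d → ℂ) : ℝ≥0∞ :=
  ∫⁻ z in Ω ×ˢ Ω, ENNReal.ofReal (φ ‖u z.1 - u z.2‖ z.1 z.2 * a (z.1 - z.2))

/-- The functional `|u|_{p,Ω} = inf {l > 0 : F(u / l) ≤ 1}`, which is `∞` if there is no such `l`. -/
def orliczGauge {d : ℕ} (Ω : Set (Euc d)) (a : Euc d → ℝ) (φ : ℝ → Euc d → Euc d → ℝ)
    (u : Euc d → ℂ) : ℝ≥0∞ :=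
  sInf (ENNReal.ofReal '' {l : ℝ | 0 < l ∧ energy Ω a φ (fun x => u x / (l : ℂ)) ≤ 1})

lemma energy_congr {d : ℕ} {Ω : Set (Euc d)} (a : Euc d → ℝ) (φ : ℝ → Euc d → Euc d → ℝ)
    {u v : Euc d → ℂ} {c : ℂ} (h : ∀ᵐ x ∂(volume.restrict Ω), u x = v x + c) :
    energy Ω a φ u = energy Ω a φ v := by
  unfold energy
  rw [Measure.volume_eq_prod, ← Measure.prod_restrict]
  refine lintegral_congr_ae ?_
  filter_upwards [Measure.quasiMeasurePreserving_fst.ae h,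
    Measure.quasiMeasurePreserving_snd.ae h] with z h1 h2
  rw [h1, h2, add_sub_add_right_eq_sub]

lemma orliczGauge_congr {d : ℕ} {Ω : Set (Euc d)} (a : Euc d → ℝ) (φ : ℝ → Euc d → Euc d → ℝ)
    {u v : Euc d → ℂ} {c : ℂ} (h : ∀ᵐ x ∂(volume.restrict Ω), u x = v x + c) :
    orliczGauge Ω a φ u = orliczGauge Ω a φ v := by
  have key : ∀ l : ℝ, energy Ω a φ (fun x => u x / (l : ℂ)) =
      energy Ω a φ (fun x => v x / (l : ℂ)) := fun l =>
    energy_congr a φ (c := c / (l : ℂ)) (h.mono fun x hx => by rw [hx, add_div])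
  simp only [orliczGauge, key]

/-- The functional `|·|_{p,Ω}` on cosets: `|U|_{p,Ω} = |u|_{p,Ω}` for any `u ∈ U`. -/
def cosetGauge {d : ℕ} (Ω : Set (Euc d)) (a : Euc d → ℝ) (φ : ℝ → Euc d → Euc d → ℝ) :
    Coset Ω → ℝ≥0∞ :=
  Quotient.lift (fun u : L1Loc Ω => orliczGauge Ω a φ u) <| by
    intro u v huv
    obtain ⟨c, hc⟩ := (Submodule.quotientRel_def _).1 huv
    have hc' : u.toAE = v.toAE + AEEqFun.const (Euc d) c := by
      have h1 : u = v + constFun Ω c := by rw [hc]; abel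
      exact congrArg L1Loc.toAE h1
    refine orliczGauge_congr a φ (c := c) ?_
    rw [hc']
    filter_upwards [AEEqFun.coeFn_add v.toAE
      (AEEqFun.const (Euc d) c), AEEqFun.coeFn_const (μ := volume.restrict Ω) (Euc d) c]
      with x h1 h2
    rw [h1, Pi.add_apply, h2, Function.const_apply]

/-- The set `Λ(Ω)` of all cosets `U` with `|U|_{p,Ω} < ∞`. -/
def cosetSpace {d : ℕ} (Ω : Set (Euc d)) (a : Euc d → ℝ) (φ : ℝ → Euc d → Euc d → ℝ) :
    Set (Coset Ω) :=
  {U | cosetGauge Ω a φ U < ∞}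

/-- The functional `f(u) = |u|_{p,Ω} + ‖u‖_{L_p(Ω)}` (used with `p = p₋`), the norm of `𝓛(Ω)`. -/
def fullNorm {d : ℕ} (Ω : Set (Euc d)) (a : Euc d → ℝ) (φ : ℝ → Euc d → Euc d → ℝ) (p : ℝ)
    (u : Euc d → ℂ) : ℝ≥0∞ :=
  orliczGauge Ω a φ u + eLpNorm u (ENNReal.ofReal p) (volume.restrict Ω)

lemma LpLoc_le_L1Loc {d : ℕ} (Ω : Set (Euc d)) {p : ℝ≥0∞} (hp : 1 ≤ p) :
    LpLoc Ω p ≤ LpLoc Ω 1 := fun u hu K hK hc => by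
  have : IsFiniteMeasure (volume.restrict K) := ⟨by simpa using hc.measure_lt_top⟩
  exact (hu K hK hc).mono_exponent hp

/-- The set `𝓛(Ω) = {u ∈ L_{p,loc}(Ω) : f(u) < ∞}` (used with `p = p₋ > 1`). It is a part of
`L_{1,loc}(Ω)`, because `L_{p,loc}(Ω)` is, see `LpLoc_le_L1Loc`. -/
def fullSpace {d : ℕ} (Ω : Set (Euc d)) (a : Euc d → ℝ) (φ : ℝ → Euc d → Euc d → ℝ) (p : ℝ) :
    Set (L1Loc Ω) :=
  {u | u.toAE ∈ LpLoc Ω (ENNReal.ofReal p) ∧ fullNorm Ω a φ p u < ∞}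

/-- The mean value `⟨u⟩_Ω = (mes Ω)⁻¹ ∫_Ω u(x) dx`. -/
def mean {d : ℕ} {Ω : Set (Euc d)} (u : L1Loc Ω) : ℂ :=
  ⨍ x in Ω, u x

/-- The function `u_⊥ = u - ⟨u⟩_Ω`. -/
def perp {d : ℕ} {Ω : Set (Euc d)} (u : L1Loc Ω) : L1Loc Ω :=
  u - constFun Ω (mean u)

/-- The conditions on the convolution kernel `a`. -/
structure KernelConditions {d : ℕ} (a : Euc d → ℝ) : Prop where
  nonneg : ∀ z, 0 ≤ a z
  integrable : Integrable a
  lower_bound : ∃ c₀ > 0, ∃ r > 0, ∀ᵐ z, z ∈ Metric.ball (0 : Euc d) r → c₀ ≤ a z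

/-- The function `r` on the positive half-line is almost increasing with the constant `β`. -/
def AlmostIncreasing (β : ℝ) (r : ℝ → ℝ) : Prop :=
  ∀ s t : ℝ, 0 < s → s ≤ t → r s ≤ β * r t

/-- The function `r` on the positive half-line is almost decreasing with the constant `β`. -/
def AlmostDecreasing (β : ℝ) (r : ℝ → ℝ) : Prop :=
  ∀ s t : ℝ, 0 < s → s ≤ t → r t ≤ β * r s

/-- The conditions on the function `φ(t, x, y)`, `t ≥ 0`, `x, y ∈ Ω`, with the exponents `pm = p₋`
and `pp = p₊`: measurability of superpositions, uniform convexity in `t`, almost monotonicity of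
`φ / t ^ p₋` and `φ / t ^ p₊`, and normalization. -/
structure PhiConditions {d : ℕ} (Ω : Set (Euc d)) (φ : ℝ → Euc d → Euc d → ℝ) (pm pp : ℝ) :
    Prop where
  nonneg : ∀ t, 0 ≤ t → ∀ x ∈ Ω, ∀ y ∈ Ω, 0 ≤ φ t x y
  measurable : ∀ u : L1Loc Ω, AEMeasurable
    (fun z : Euc d × Euc d => φ ‖u z.1 - u z.2‖ z.1 z.2) (volume.restrict (Ω ×ˢ Ω))
  uniformly_convex : ∀ ε > 0, ∃ δ : ℝ, 0 < δ ∧ δ < 1 ∧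
    ∀ᵐ z : Euc d × Euc d ∂(volume.restrict (Ω ×ˢ Ω)), ∀ s t : ℝ, 0 < s → 0 < t →
      ε * max s t ≤ |s - t| →
      φ ((s + t) / 2) z.1 z.2 ≤ (1 - δ) * ((φ s z.1 z.2 + φ t z.1 z.2) / 2)
  one_lt : 1 < pm
  le : pm ≤ pp
  almost_monotone : ∃ β : ℝ, 1 ≤ β ∧ ∀ᵐ z : Euc d × Euc d ∂(volume.restrict (Ω ×ˢ Ω)),
    AlmostIncreasing β (fun t => φ t z.1 z.2 / t ^ pm) ∧
    AlmostDecreasing β (fun t => φ t z.1 z.2 / t ^ pp)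
  bound : ∃ c₁ : ℝ, 0 < c₁ ∧ ∀ᵐ z : Euc d × Euc d ∂(volume.restrict (Ω ×ˢ Ω)),
    c₁⁻¹ ≤ φ 1 z.1 z.2 ∧ φ 1 z.1 z.2 ≤ c₁
  zero_pos : ∀ᵐ z : Euc d × Euc d ∂(volume.restrict (Ω ×ˢ Ω)),
    φ 0 z.1 z.2 = 0 ∧ ∀ t : ℝ, 0 < t → 0 < φ t z.1 z.2

/-- The functional `N` is finite on the linear space `W`, is a norm on it, and `W` with this norm is
complete. -/
def IsBanachUnder {V : Type*} [AddCommGroup V] [Module ℂ V] (W : Submodule ℂ V) (N : V → ℝ≥0∞) :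
    Prop :=
  (∀ v ∈ W, N v < ∞) ∧
  letI : Norm W := ⟨fun v => (N v).toReal⟩
  ∃ core : NormedSpace.Core ℂ W,
    letI : NormedAddCommGroup W := NormedAddCommGroup.ofCore core
    CompleteSpace W

end NonlocalOrlicz

end

open NonlocalOrlicz

/-! Almost every section `φ(·, x, y)` is convex on the half-line: uniform convexity yields midpoint
convexity, the growth conditions yield local boundedness and decay at the origin, and
Bernstein–Doetsch does the rest (`PhiConditions.ae_isYoung`). Hence the energy is convex and its
Luxemburg gauge is a seminorm. It does not see constants, because the energy depends only on
differences.

The central fact is a nonlocal Poincaré inequality, `exists_eLpNorm_sub_mean_le`: the `L_{p₋}`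
distance of `u` from its mean is at most a constant times the gauge of `u`. On pairs of points
closer than some `r` the kernel is bounded below and `t ^ p₋ ≤ 1 + C φ(t)`, so energy at most one
bounds the integral of `|w(x) - w(y)| ^ p₋` over close pairs. Connectedness of `Ω` carries this
bound to distant pairs along chains of small balls, and boundedness makes finitely many balls enough
(`exists_pairEnergy_self_le`). Freezing one variable at a good point then bounds the distance from a
constant.

The claims follow. Zero gauge forces a constant, and finite gauge forces membership in `L_{p₋}`;
prescribing the mean singles out one representative of a coset, and the norms compare by the
triangle inequality. For completeness, the mean-zero representatives of a Cauchy sequence converge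
in `L_{p₋}`, a subsequence converges a.e., and Fatou's lemma (`orliczGauge_le_of_tendsto`) turns the
limit into a limit in the gauge. -/

namespace NonlocalOrlicz

/-! ### Convexity of the sections of `φ` -/

/-- A midpoint convex function on a segment that is bounded above there lies below its chord. -/
lemma le_zero_of_midpointConvex {g : ℝ → ℝ} {s t : ℝ}
    (hs : g s = 0) (ht : g t = 0)
    (hmid : ∀ x ∈ Set.Icc s t, ∀ y ∈ Set.Icc s t, g ((x + y) / 2) ≤ (g x + g y) / 2)
    (hb : BddAbove (g '' Set.Icc s t)) {x : ℝ} (hx : x ∈ Set.Icc s t) : g x ≤ 0 := by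
  have hle : ∀ y ∈ Set.Icc s t, g y ≤ sSup (g '' Set.Icc s t) := fun y hy =>
    le_csSup hb ⟨y, hy, rfl⟩
  -- Each `y` is the midpoint of the nearer endpoint, where `g` vanishes, and a point of the
  -- segment; so the supremum is at most half of itself.
  have key : ∀ y ∈ Set.Icc s t, g y ≤ sSup (g '' Set.Icc s t) / 2 := by
    rintro y ⟨hy1, hy2⟩
    rcases le_total y ((s + t) / 2) with h | h
    · have h1 := hmid s ⟨le_rfl, by linarith⟩ (2 * y - s) ⟨by linarith, by linarith⟩
      have h2 := hle (2 * y - s) ⟨by linarith, by linarith⟩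
      rw [show (s + (2 * y - s)) / 2 = y by ring] at h1
      linarith
    · have h1 := hmid t ⟨by linarith, le_rfl⟩ (2 * y - t) ⟨by linarith, by linarith⟩
      have h2 := hle (2 * y - t) ⟨by linarith, by linarith⟩
      rw [show (t + (2 * y - t)) / 2 = y by ring] at h1
      linarith
  have h3 : sSup (g '' Set.Icc s t) ≤ sSup (g '' Set.Icc s t) / 2 := by
    refine csSup_le ⟨g x, x, hx, rfl⟩ ?_
    rintro _ ⟨y, hy, rfl⟩
    exact key y hy
  linarith [hle x hx]

/-- Bernstein–Doetsch: midpoint convexity and local boundedness imply convexity. -/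
lemma convexOn_of_midpointConvex {f : ℝ → ℝ}
    (hmid : ∀ s t : ℝ, 0 < s → 0 < t → f ((s + t) / 2) ≤ (f s + f t) / 2)
    (hb : ∀ s t : ℝ, 0 < s → s ≤ t → BddAbove (f '' Set.Icc s t)) :
    ConvexOn ℝ (Set.Ioi 0) f := by
  refine LinearOrder.convexOn_of_lt (convex_Ioi 0) ?_
  intro s hs t ht hst α b hα hb' hab
  have hs : 0 < s := hs
  set k : ℝ := (f t - f s) / (t - s) with hk
  set g : ℝ → ℝ := fun x => f x - (f s + k * (x - s)) with hg
  have hts : t - s ≠ 0 := by linarith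
  have hkt : k * (t - s) = f t - f s := by rw [hk]; field_simp
  -- Subtracting the chord, of slope `k`, keeps midpoint convexity and makes both endpoint values
  -- zero.
  have h := le_zero_of_midpointConvex (g := g) (s := s) (t := t) (x := α * s + b * t)
    (by simp [hg]) (by simp [hg, hkt]) (fun x hx y hy => ?_) ?_ ⟨?_, ?_⟩
  · have h4 : k * (α * s + b * t - s) = b * (f t - f s) := by
      rw [← hkt, show α = 1 - b by linarith]; ring
    simp only [hg, h4] at h
    rw [show α = 1 - b by linarith] at h ⊢
    simp only [smul_eq_mul]
    linarith
  · have := hmid x y (hs.trans_le hx.1) (hs.trans_le hy.1)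
    simp only [hg]
    linarith
  · obtain ⟨M, hM⟩ := hb s t hs hst.le
    refine ⟨M - f s + |k| * (t - s), ?_⟩
    rintro _ ⟨x, hx, rfl⟩
    have h1 := hM ⟨x, hx, rfl⟩
    have h2 : -(k * (x - s)) ≤ |k| * (t - s) := by
      calc -(k * (x - s)) ≤ |k * (x - s)| := neg_le_abs _
        _ = |k| * (x - s) := by rw [abs_mul, abs_of_nonneg (by linarith [hx.1] : 0 ≤ x - s)]
        _ ≤ |k| * (t - s) := by gcongr; exact hx.2
    simp only [hg]
    linarith
  · rw [show α = 1 - b by linarith]; nlinarith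
  · rw [show b = 1 - α by linarith]; nlinarith

/-- Convex non-negative functions on the half-line that vanish at the origin. -/
structure IsYoung (f : ℝ → ℝ) : Prop where
  convexOn : ConvexOn ℝ (Set.Ici 0) f
  zero : f 0 = 0
  nonneg : ∀ t, 0 ≤ t → 0 ≤ f t

lemma IsYoung.mono {f : ℝ → ℝ} (hf : IsYoung f) {s t : ℝ} (hs : 0 ≤ s) (hst : s ≤ t) :
    f s ≤ f t := by
  rcases hs.eq_or_lt with rfl | hs0
  · rw [hf.zero]; exact hf.nonneg t hst
  have ht0 : 0 < t := hs0.trans_le hst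
  have h := hf.convexOn.2 (Set.mem_Ici.2 le_rfl) (Set.mem_Ici.2 ht0.le)
    (sub_nonneg.2 ((div_le_one ht0).2 hst)) (div_nonneg hs ht0.le) (by ring)
  simp only [smul_eq_mul, mul_zero, zero_add, hf.zero, div_mul_cancel₀ s ht0.ne'] at h
  refine h.trans ?_
  have := hf.nonneg t ht0.le
  exact mul_le_of_le_one_left this ((div_le_one ht0).2 hst)

lemma IsYoung.continuousAt {f : ℝ → ℝ} (hf : IsYoung f) {t : ℝ} (ht : 0 < t) :
    ContinuousAt f t :=
  ((hf.convexOn.subset Set.Ioi_subset_Ici_self (convex_Ioi 0)).continuousOn isOpen_Ioi).continuousAt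
    (Ioi_mem_nhds ht)

/-- Young functions are lower semicontinuous on the half-line. -/
lemma IsYoung.ofReal_le_liminf {f : ℝ → ℝ} (hf : IsYoung f) {c : ℝ} {s : ℕ → ℝ} {t : ℝ}
    (ht : 0 ≤ t) (hst : Tendsto s atTop (𝓝 t)) :
    ENNReal.ofReal (f t * c) ≤ liminf (fun n => ENNReal.ofReal (f (s n) * c)) atTop := by
  rcases ht.eq_or_lt with rfl | h0
  -- At `t = 0` the left side vanishes, so continuity is needed only at interior points.
  · simp [hf.zero]
  · refine (Tendsto.liminf_eq ?_).ge
    exact ENNReal.tendsto_ofReal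
      (((hf.continuousAt h0).tendsto.comp hst).mul_const c)

lemma IsYoung.convex_combination_le {f : ℝ → ℝ} (hf : IsYoung f) {s t x : ℝ} {α β : ℝ}
    (hs : 0 ≤ s) (ht : 0 ≤ t) (hα : 0 ≤ α) (hβ : 0 ≤ β) (hαβ : α + β = 1) (hx0 : 0 ≤ x)
    (hx : x ≤ α * s + β * t) : f x ≤ α * f s + β * f t :=
  (hf.mono hx0 hx).trans (hf.convexOn.2 hs ht hα hβ hαβ)

/-- The bound by `t ^ pp` gives the local boundedness required by Bernstein–Doetsch on the open
half-line. The bound by `t ^ pm` forces `f → 0` at the origin, and letting the left endpoint of a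
chord tend to `0` extends convexity to the closed half-line. -/
lemma isYoung_of_almostMonotone {f : ℝ → ℝ} {β pm pp : ℝ} (hpm : 1 < pm) (hpp : 1 < pp)
    (hβ : 1 ≤ β)
    (hmid : ∀ s t : ℝ, 0 < s → 0 < t → f ((s + t) / 2) ≤ (f s + f t) / 2)
    (hinc : AlmostIncreasing β fun t => f t / t ^ pm)
    (hdec : AlmostDecreasing β fun t => f t / t ^ pp)
    (hzero : f 0 = 0) (hpos : ∀ t, 0 < t → 0 < f t) : IsYoung f := by
  have hβ0 : 0 < β := by linarith
  have hconv : ConvexOn ℝ (Set.Ioi 0) f := by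
    refine convexOn_of_midpointConvex hmid fun s t hs hst => ?_
    refine ⟨β * (f s / s ^ pp) * t ^ pp, ?_⟩
    rintro _ ⟨x, hx, rfl⟩
    have hx0 : 0 < x := hs.trans_le hx.1
    have h1 := hdec s x hs hx.1
    simp only at h1
    rw [div_le_iff₀ (Real.rpow_pos_of_pos hx0 pp)] at h1
    refine h1.trans ?_
    have := (hpos s hs).le
    have := Real.rpow_le_rpow hx0.le hx.2 (by linarith : 0 ≤ pp)
    gcongr
  have hlim : Tendsto f (𝓝[>] 0) (𝓝 0) := by
    have hlim1 : Tendsto (fun η : ℝ => β * f 1 * η ^ pm) (𝓝[>] 0) (𝓝 0) := by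
      have : ContinuousAt (fun η : ℝ => β * f 1 * η ^ pm) 0 :=
        continuousAt_const.mul (Real.continuousAt_rpow_const 0 pm (Or.inr (by linarith)))
      have h := this.tendsto
      rw [Real.zero_rpow (by linarith), mul_zero] at h
      exact h.mono_left nhdsWithin_le_nhds
    refine tendsto_of_tendsto_of_tendsto_of_le_of_le' tendsto_const_nhds hlim1 ?_ ?_
    · filter_upwards [self_mem_nhdsWithin] with η hη using (hpos η hη).le
    · filter_upwards [Ioo_mem_nhdsGT (zero_lt_one (α := ℝ))] with η hη
      have h1 := hinc η 1 hη.1 hη.2.le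
      simp only [Real.one_rpow, div_one] at h1
      rwa [div_le_iff₀ (Real.rpow_pos_of_pos hη.1 pm)] at h1
  have hstar : ∀ s t : ℝ, 0 < s → s ≤ t → f s ≤ s / t * f t := by
    intro s t hs hst
    have ht : 0 < t := hs.trans_le hst
    have hl : Tendsto (fun η => f η + s / t * f t) (𝓝[>] 0) (𝓝 (0 + s / t * f t)) :=
      hlim.add_const _
    rw [zero_add] at hl
    refine ge_of_tendsto hl ?_
    filter_upwards [Ioo_mem_nhdsGT hs] with η hη
    rcases hst.eq_or_lt with rfl | hst
    · rw [div_self hs.ne', one_mul]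
      linarith [hpos η hη.1]
    have hd : 0 < t - η := by linarith [hη.2]
    have h := hconv.2 (Set.mem_Ioi.2 hη.1) (Set.mem_Ioi.2 ht)
      (div_nonneg (by linarith) hd.le : 0 ≤ (t - s) / (t - η))
      (div_nonneg (by linarith [hη.2]) hd.le : 0 ≤ (s - η) / (t - η))
      (by field_simp; ring)
    simp only [smul_eq_mul] at h
    have e : (t - s) / (t - η) * η + (s - η) / (t - η) * t = s := by field_simp; ring
    rw [e] at h
    -- The weights of `η` and `t` are at most `1` and `s / t`, which leaves `f s ≤ f η + s / t * f
    -- t`; the first term dies as `η → 0`.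
    have h1 : (t - s) / (t - η) ≤ 1 := (div_le_one hd).2 (by linarith [hη.2])
    have h2 : (s - η) / (t - η) ≤ s / t := by
      rw [div_le_div_iff₀ hd ht]; nlinarith [hη.1]
    have h3 := mul_le_mul_of_nonneg_right h1 (hpos η hη.1).le
    have h4 := mul_le_mul_of_nonneg_right h2 (hpos t ht).le
    linarith
  have hscale : ∀ c t : ℝ, 0 ≤ c → c ≤ 1 → 0 < t → f (c * t) ≤ c * f t := by
    intro c t hc hc1 ht
    rcases hc.eq_or_lt with rfl | hc0
    · simp [hzero]
    · have := hstar (c * t) t (mul_pos hc0 ht) (mul_le_of_le_one_left ht.le hc1)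
      rwa [mul_div_cancel_right₀ c ht.ne'] at this
  refine ⟨⟨convex_Ici 0, ?_⟩, hzero, fun t ht => ?_⟩
  · intro x hx y hy b c hb hc hbc
    rcases (Set.mem_Ici.1 hx).eq_or_lt with rfl | hx0
    · rcases (Set.mem_Ici.1 hy).eq_or_lt with rfl | hy0
      · simp [hzero]
      · simpa [hzero] using hscale c y hc (by linarith) hy0
    · rcases (Set.mem_Ici.1 hy).eq_or_lt with rfl | hy0
      · simpa [hzero] using hscale b x hb (by linarith) hx0
      · exact hconv.2 hx0 hy0 hb hc hbc
  · rcases ht.eq_or_lt with rfl | h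
    · rw [hzero]
    · exact (hpos t h).le

/-- The summand `1` covers `t ≤ 1`; for `t ≥ 1` almost monotonicity compares `f t / t ^ pm` with `f
1 ≥ c⁻¹`. -/
lemma rpow_le_one_add_of_almostIncreasing {f : ℝ → ℝ} {β pm c : ℝ} (hpm : 0 ≤ pm) (hβ : 0 ≤ β)
    (hc : 0 < c) (hinc : AlmostIncreasing β fun t => f t / t ^ pm) (h1 : c⁻¹ ≤ f 1)
    (hpos : ∀ t, 0 ≤ t → 0 ≤ f t) {t : ℝ} (ht : 0 ≤ t) : t ^ pm ≤ 1 + β * c * f t := by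
  have h0 : 0 ≤ β * c * f t := by have := hpos t ht; positivity
  rcases le_total t 1 with h | h
  · linarith [Real.rpow_le_one ht h hpm]
  · have ht0 : 0 < t := by linarith
    have h2 := hinc 1 t one_pos h
    simp only [Real.one_rpow, div_one] at h2
    have h3 := h1.trans h2
    have hp := Real.rpow_pos_of_pos ht0 pm
    rw [inv_le_iff_one_le_mul₀ hc, ← mul_div_assoc, div_mul_eq_mul_div, one_le_div hp] at h3
    linarith

/-- Almost every section `φ(·, x, y)` is a Young function with a lower growth bound. -/
lemma PhiConditions.ae_isYoung {d : ℕ} {Ω : Set (Euc d)} {φ : ℝ → Euc d → Euc d → ℝ} {pm pp : ℝ}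
    (hφ : PhiConditions Ω φ pm pp) :
    ∃ C : ℝ≥0, ∀ᵐ z : Euc d × Euc d ∂(volume.restrict (Ω ×ˢ Ω)),
      IsYoung (fun t => φ t z.1 z.2) ∧ ∀ t, 0 ≤ t → t ^ pm ≤ 1 + C * φ t z.1 z.2 := by
  obtain ⟨β, hβ, hmon⟩ := hφ.almost_monotone
  obtain ⟨c, hc, hbd⟩ := hφ.bound
  -- The exceptional null set depends on `ε`, so only the countable family `ε = 1 / (n + 1)` is
  -- used; any `s ≠ t` is separated enough for some `n`. The gain `δ` is discarded.
  have hconv : ∀ n : ℕ, ∀ᵐ z : Euc d × Euc d ∂(volume.restrict (Ω ×ˢ Ω)), ∀ s t : ℝ, 0 < s →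
      0 < t → (1 / ((n : ℝ) + 1)) * max s t ≤ |s - t| →
      φ ((s + t) / 2) z.1 z.2 ≤ (φ s z.1 z.2 + φ t z.1 z.2) / 2 := by
    intro n
    obtain ⟨δ, hδ, hδ1, h⟩ := hφ.uniformly_convex (1 / ((n : ℝ) + 1)) (by positivity)
    filter_upwards [h, hφ.zero_pos] with z hz hz0 s t hs ht hst
    have h1 := hz s t hs ht hst
    have h2 := hz0.2 s hs
    have h3 := hz0.2 t ht
    refine h1.trans (mul_le_of_le_one_left (by positivity) (by linarith))
  refine ⟨⟨β * c, by positivity⟩, ?_⟩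
  filter_upwards [hmon, hbd, hφ.zero_pos, ae_all_iff.2 hconv] with z h1 h2 h3 h4
  have hY : IsYoung (fun t => φ t z.1 z.2) := by
    refine isYoung_of_almostMonotone hφ.one_lt (hφ.one_lt.trans_le hφ.le) hβ ?_ h1.1 h1.2 h3.1 h3.2
    intro s t hs ht
    by_cases hst : s = t
    · subst hst
      rw [show (s + s) / 2 = s by ring]; linarith
    · obtain ⟨n, hn⟩ := exists_nat_one_div_lt
        (div_pos (abs_pos.2 (sub_ne_zero.2 hst)) (lt_max_of_lt_left hs : 0 < max s t))
      refine h4 n s t hs ht ?_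
      rw [lt_div_iff₀ (lt_max_of_lt_left hs)] at hn
      exact hn.le
  exact ⟨hY, fun t ht => rpow_le_one_add_of_almostIncreasing (by linarith [hφ.one_lt])
    (by linarith) hc h1.1 h2.1 hY.nonneg ht⟩

/-! ### The Luxemburg gauge is a seminorm -/

section Energy

variable {d : ℕ} {Ω : Set (Euc d)} {a : Euc d → ℝ} {φ : ℝ → Euc d → Euc d → ℝ} {pm pp : ℝ}

lemma L1Loc.coeFn_add (u v : L1Loc Ω) :
    ∀ᵐ x ∂(volume.restrict Ω), (u + v) x = u x + v x :=
  AEEqFun.coeFn_add u.toAE v.toAE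

lemma L1Loc.coeFn_sub (u v : L1Loc Ω) :
    ∀ᵐ x ∂(volume.restrict Ω), (u - v) x = u x - v x :=
  AEEqFun.coeFn_sub u.toAE v.toAE

lemma L1Loc.coeFn_smul (c : ℂ) (u : L1Loc Ω) :
    ∀ᵐ x ∂(volume.restrict Ω), (c • u) x = c * u x :=
  AEEqFun.coeFn_smul c u.toAE

lemma L1Loc.coeFn_zero : ∀ᵐ x ∂(volume.restrict Ω), (0 : L1Loc Ω) x = 0 :=
  AEEqFun.coeFn_zero

lemma coeFn_constFun (c : ℂ) : ∀ᵐ x ∂(volume.restrict Ω), constFun Ω c x = c :=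
  AEEqFun.coeFn_const (Euc d) c

lemma L1Loc.stronglyMeasurable (u : L1Loc Ω) : StronglyMeasurable u :=
  u.toAE.stronglyMeasurable

lemma L1Loc.ext {u v : L1Loc Ω} (h : ∀ᵐ x ∂(volume.restrict Ω), u x = v x) : u = v :=
  Subtype.ext (AEEqFun.ext h)

lemma ae_restrict_prod {P : Euc d → Prop} (h : ∀ᵐ x ∂(volume.restrict Ω), P x) :
    ∀ᵐ z : Euc d × Euc d ∂(volume.restrict (Ω ×ˢ Ω)), P z.1 ∧ P z.2 := by
  rw [Measure.volume_eq_prod, ← Measure.prod_restrict]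
  filter_upwards [Measure.quasiMeasurePreserving_fst.ae h,
    Measure.quasiMeasurePreserving_snd.ae h] with z h1 h2 using ⟨h1, h2⟩

lemma KernelConditions.aemeasurable_sub (ha : KernelConditions a) :
    AEMeasurable (fun z : Euc d × Euc d => a (z.1 - z.2)) (volume.restrict (Ω ×ˢ Ω)) := by
  refine AEMeasurable.restrict ?_
  rw [Measure.volume_eq_prod]
  exact ha.integrable.aemeasurable.comp_quasiMeasurePreserving
    (quasiMeasurePreserving_sub volume volume)

lemma aemeasurable_energy_integrand (ha : KernelConditions a) (hφ : PhiConditions Ω φ pm pp)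
    (u : L1Loc Ω) (l : ℂ) :
    AEMeasurable (fun z : Euc d × Euc d =>
      ENNReal.ofReal (φ ‖u z.1 / l - u z.2 / l‖ z.1 z.2 * a (z.1 - z.2)))
      (volume.restrict (Ω ×ˢ Ω)) := by
  -- Measurability of superpositions is given only for elements of `L1Loc Ω`, so the quotient by `l`
  -- is read as the element `l⁻¹ • u`.
  refine AEMeasurable.ennreal_ofReal (AEMeasurable.mul ?_ ha.aemeasurable_sub)
  refine (hφ.measurable (l⁻¹ • u)).congr ?_
  filter_upwards [ae_restrict_prod (L1Loc.coeFn_smul l⁻¹ u)] with z hz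
  rw [hz.1, hz.2, div_eq_inv_mul, div_eq_inv_mul]

lemma orliczGauge_le_of_energy_le {u : Euc d → ℂ} {l : ℝ} (hl : 0 < l)
    (h : energy Ω a φ (fun x => u x / (l : ℂ)) ≤ 1) : orliczGauge Ω a φ u ≤ ENNReal.ofReal l :=
  sInf_le ⟨l, ⟨hl, h⟩, rfl⟩

lemma exists_energy_le_of_orliczGauge_lt {u : Euc d → ℂ} {x : ℝ≥0∞}
    (h : orliczGauge Ω a φ u < x) :
    ∃ l : ℝ, 0 < l ∧ energy Ω a φ (fun x => u x / (l : ℂ)) ≤ 1 ∧ ENNReal.ofReal l < x := by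
  obtain ⟨_, ⟨l, ⟨hl, hE⟩, rfl⟩, hx⟩ := sInf_lt_iff.1 h
  exact ⟨l, hl, hE, hx⟩

/-- `(u + v) / (l + m)` is the convex combination of `u / l` and `v / m` with weights `l / (l + m)`
and `m / (l + m)`, and the sections of `φ` are increasing and convex. -/
lemma energy_convex_combination_le (ha : KernelConditions a) (hφ : PhiConditions Ω φ pm pp)
    (u v : L1Loc Ω) {l m : ℝ} (hl : 0 < l) (hm : 0 < m) :
    energy Ω a φ (fun x => (u + v) x / ((l + m : ℝ) : ℂ)) ≤
      ENNReal.ofReal (l / (l + m)) * energy Ω a φ (fun x => u x / (l : ℂ)) +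
      ENNReal.ofReal (m / (l + m)) * energy Ω a φ (fun x => v x / (m : ℂ)) := by
  obtain ⟨C, hC⟩ := hφ.ae_isYoung
  unfold energy
  have hlm : 0 < l + m := by positivity
  rw [← lintegral_const_mul' _ _ ENNReal.ofReal_ne_top,
    ← lintegral_const_mul' _ _ ENNReal.ofReal_ne_top,
    ← lintegral_add_left' ((aemeasurable_energy_integrand ha hφ u l).const_mul _)]
  refine lintegral_mono_ae ?_
  filter_upwards [hC, ae_restrict_prod (L1Loc.coeFn_add u v)] with z hY hz
  rw [hz.1, hz.2, ← ENNReal.ofReal_mul (by positivity), ← ENNReal.ofReal_mul (by positivity),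
    ← ENNReal.ofReal_add]
  · refine ENNReal.ofReal_le_ofReal ?_
    rw [← mul_assoc, ← mul_assoc, ← add_mul]
    refine mul_le_mul_of_nonneg_right ?_ (ha.nonneg _)
    refine hY.1.convex_combination_le (norm_nonneg _) (norm_nonneg _) (by positivity)
      (by positivity) (by field_simp) (norm_nonneg _) ?_
    have hl' : (l : ℂ) ≠ 0 := by exact_mod_cast hl.ne'
    have hm' : (m : ℂ) ≠ 0 := by exact_mod_cast hm.ne'
    have hlm' : (l + m : ℂ) ≠ 0 := by exact_mod_cast hlm.ne'
    have e : (u z.1 + v z.1) / ((l + m : ℝ) : ℂ) - (u z.2 + v z.2) / ((l + m : ℝ) : ℂ) =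
        ((l / (l + m) : ℝ) : ℂ) * (u z.1 / l - u z.2 / l) +
        ((m / (l + m) : ℝ) : ℂ) * (v z.1 / m - v z.2 / m) := by
      push_cast; field_simp; ring
    rw [e]
    refine (norm_add_le _ _).trans_eq ?_
    rw [norm_mul, norm_mul, Complex.norm_of_nonneg (by positivity),
      Complex.norm_of_nonneg (by positivity)]
  · have := hY.1.nonneg _ (norm_nonneg (u z.1 / l - u z.2 / l))
    have := ha.nonneg (z.1 - z.2)
    positivity
  · have := hY.1.nonneg _ (norm_nonneg (v z.1 / m - v z.2 / m))
    have := ha.nonneg (z.1 - z.2)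
    positivity

lemma orliczGauge_add_le (ha : KernelConditions a) (hφ : PhiConditions Ω φ pm pp)
    (u v : L1Loc Ω) :
    orliczGauge Ω a φ (u + v : L1Loc Ω) ≤ orliczGauge Ω a φ u + orliczGauge Ω a φ v := by
  refine le_of_forall_gt_imp_ge_of_dense fun x hx => ?_
  by_cases hu : orliczGauge Ω a φ u = ∞
  · simp [hu] at hx
  by_cases hv : orliczGauge Ω a φ v = ∞
  · simp [hv] at hx
  -- The slack between the sum of the gauges and `y` is shared by the two summands, indexed by
  -- `Bool`.
  obtain ⟨x₁, hx₁, x₂, hx₂, h12⟩ : ∃ x₁, orliczGauge Ω a φ u < x₁ ∧ ∃ x₂,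
      orliczGauge Ω a φ v < x₂ ∧ x₁ + x₂ ≤ x := by
    obtain ⟨y, hy, hyx⟩ := exists_between hx
    have hyt : y ≠ ∞ := (hyx.trans_le le_top).ne
    obtain ⟨ε, hε, h⟩ := ENNReal.exists_pos_sum_of_countable' (ι := Bool)
      (tsub_pos_of_lt hy).ne'
    simp only [tsum_fintype, Fintype.sum_bool] at h
    refine ⟨_, ENNReal.lt_add_right hu (hε true).ne', _, ENNReal.lt_add_right hv (hε false).ne', ?_⟩
    calc _ = (orliczGauge Ω a φ u + orliczGauge Ω a φ v) + (ε true + ε false) := by abel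
      _ ≤ (orliczGauge Ω a φ u + orliczGauge Ω a φ v) +
          (y - (orliczGauge Ω a φ u + orliczGauge Ω a φ v)) := by gcongr
      _ = y := add_tsub_cancel_of_le hy.le
      _ ≤ x := hyx.le
  obtain ⟨l, hl, hEl, hlx⟩ := exists_energy_le_of_orliczGauge_lt hx₁
  obtain ⟨m, hm, hEm, hmx⟩ := exists_energy_le_of_orliczGauge_lt hx₂
  refine (orliczGauge_le_of_energy_le (add_pos hl hm) ?_).trans ?_
  · refine (energy_convex_combination_le ha hφ u v hl hm).trans ?_
    calc _ ≤ ENNReal.ofReal (l / (l + m)) * 1 + ENNReal.ofReal (m / (l + m)) * 1 := by gcongr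
      _ = 1 := by
        rw [mul_one, mul_one, ← ENNReal.ofReal_add (by positivity) (by positivity), ← add_div,
          div_self (by positivity), ENNReal.ofReal_one]
  · rw [ENNReal.ofReal_add hl.le hm.le]
    exact (add_le_add hlx.le hmx.le).trans h12

/-- All differences vanish and `φ(0) = 0`, so every `l > 0` is admissible. -/
lemma orliczGauge_eq_zero_of_ae_eq_const (hφ : PhiConditions Ω φ pm pp) {u : Euc d → ℂ} {c : ℂ}
    (h : ∀ᵐ x ∂(volume.restrict Ω), u x = c) : orliczGauge Ω a φ u = 0 := by
  rw [orliczGauge_congr a φ (v := fun _ => 0) (c := c) (by simpa using h)]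
  refine le_antisymm (le_of_forall_gt_imp_ge_of_dense fun x hx => ?_) zero_le
  obtain ⟨l, hl, hlx⟩ : ∃ l : ℝ, 0 < l ∧ ENNReal.ofReal l ≤ x := by
    rcases eq_or_ne x ∞ with rfl | hx'
    · exact ⟨1, one_pos, le_top⟩
    · exact ⟨x.toReal, ENNReal.toReal_pos hx.ne' hx', ENNReal.ofReal_toReal_le⟩
  refine (orliczGauge_le_of_energy_le hl ?_).trans hlx
  have : energy Ω a φ (fun _ => (0 : ℂ) / (l : ℂ)) = 0 := by
    unfold energy
    refine (lintegral_congr_ae ?_).trans lintegral_zero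
    filter_upwards [hφ.zero_pos] with z hz
    simp [hz.1]
  rw [this]
  exact zero_le_one

lemma orliczGauge_smul_le (hφ : PhiConditions Ω φ pm pp) (c : ℂ) (u : L1Loc Ω) :
    orliczGauge Ω a φ (c • u : L1Loc Ω) ≤ ‖c‖ₑ * orliczGauge Ω a φ u := by
  rcases eq_or_ne c 0 with rfl | hc
  · rw [zero_smul, orliczGauge_eq_zero_of_ae_eq_const hφ L1Loc.coeFn_zero]
    exact zero_le
  -- With `‖c‖ₑ` moved to the left, the claim is a lower bound for an infimum: if `l` is admissible
  -- for `u`, then `l * ‖c‖` is admissible for `c • u`.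
  rw [mul_comm, ← ENNReal.div_le_iff (by simpa using hc) enorm_ne_top]
  refine le_sInf ?_
  rintro _ ⟨l, ⟨hl, hE⟩, rfl⟩
  rw [ENNReal.div_le_iff (by simpa using hc) enorm_ne_top, ← ofReal_norm,
    ← ENNReal.ofReal_mul hl.le]
  refine orliczGauge_le_of_energy_le (mul_pos hl (norm_pos_iff.2 hc)) (le_trans (le_of_eq ?_) hE)
  refine lintegral_congr_ae ?_
  filter_upwards [ae_restrict_prod (L1Loc.coeFn_smul c u)] with z hz
  rw [hz.1, hz.2, ← sub_div, ← sub_div, ← mul_sub, norm_div, norm_mul, norm_div,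
    Complex.norm_of_nonneg hl.le, Complex.norm_of_nonneg (by positivity), mul_comm l,
    mul_div_mul_left _ _ (norm_ne_zero_iff.2 hc)]

/-- The reverse inequality is `orliczGauge_smul_le` applied to `c⁻¹` and `c • u`. -/
lemma orliczGauge_smul (hφ : PhiConditions Ω φ pm pp) (c : ℂ) (u : L1Loc Ω) :
    orliczGauge Ω a φ (c • u : L1Loc Ω) = ‖c‖ₑ * orliczGauge Ω a φ u := by
  refine le_antisymm (orliczGauge_smul_le hφ c u) ?_
  rcases eq_or_ne c 0 with rfl | hc
  · simp
  have h := orliczGauge_smul_le (a := a) hφ c⁻¹ (c • u)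
  rw [inv_smul_smul₀ hc, enorm_inv hc, mul_comm, ← div_eq_mul_inv,
    ENNReal.le_div_iff_mul_le (Or.inl (by simpa using hc)) (Or.inl enorm_ne_top)] at h
  rwa [mul_comm]

end Energy

/-! ### From close pairs of points to all pairs -/

section Poincare

variable {d : ℕ} {Ω : Set (Euc d)} {p : ℝ}

/-- The integral of `|w(x) - w(y)| ^ p` over `A × B`. -/
noncomputable def pairEnergy (p : ℝ) (w : Euc d → ℂ) (A B : Set (Euc d)) : ℝ≥0∞ :=
  ∫⁻ x in A, ∫⁻ y in B, ‖w x - w y‖ₑ ^ p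

/-- The integral of `|w(x) - w(y)| ^ p` over the pairs of points of `Ω` at distance less than `r`. -/
noncomputable def localEnergy (p : ℝ) (Ω : Set (Euc d)) (r : ℝ) (w : Euc d → ℂ) : ℝ≥0∞ :=
  ∫⁻ z in (Ω ×ˢ Ω) ∩ {z : Euc d × Euc d | dist z.1 z.2 < r}, ‖w z.1 - w z.2‖ₑ ^ p

lemma measurable_pair {w : Euc d → ℂ} (hw : Measurable w) :
    Measurable (fun z : Euc d × Euc d => ‖w z.1 - w z.2‖ₑ ^ p) := by fun_prop

lemma pairEnergy_comm {w : Euc d → ℂ} (hw : Measurable w) (A B : Set (Euc d)) :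
    pairEnergy p w A B = pairEnergy p w B A := by
  unfold pairEnergy
  rw [lintegral_lintegral_swap (measurable_pair hw).aemeasurable]
  simp only [enorm_sub_rev]

lemma pairEnergy_eq_lintegral_prod {w : Euc d → ℂ} (hw : Measurable w) (A B : Set (Euc d)) :
    pairEnergy p w A B = ∫⁻ z in A ×ˢ B, ‖w z.1 - w z.2‖ₑ ^ p := by
  rw [Measure.volume_eq_prod, ← Measure.prod_restrict,
    lintegral_prod _ (measurable_pair hw).aemeasurable, pairEnergy]

lemma pairEnergy_le_localEnergy {w : Euc d → ℂ} (hw : Measurable w) {A B : Set (Euc d)} {r : ℝ}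
    (hA : A ⊆ Ω) (hB : B ⊆ Ω) (h : ∀ x ∈ A, ∀ y ∈ B, dist x y < r) :
    pairEnergy p w A B ≤ localEnergy p Ω r w := by
  rw [pairEnergy_eq_lintegral_prod hw]
  exact lintegral_mono_set fun z hz => ⟨⟨hA hz.1, hB hz.2⟩, h _ hz.1 _ hz.2⟩

/-- For each intermediate value `w y`, the triangle inequality and convexity of the `p`-th power
split `|w x - w z| ^ p`; integrating over `y ∈ B` produces the factor `volume B`. -/
lemma pairEnergy_triangle (hp : 1 ≤ p) {w : Euc d → ℂ} (hw : Measurable w)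
    (A B D : Set (Euc d)) :
    volume B * pairEnergy p w A D ≤ 2 ^ (p - 1) *
      (volume D * pairEnergy p w A B + volume A * pairEnergy p w B D) := by
  have hm := measurable_pair (p := p) hw
  have h1 : ∀ y, pairEnergy p w A D ≤ 2 ^ (p - 1) *
      (volume D * (∫⁻ x in A, ‖w x - w y‖ₑ ^ p) +
        volume A * (∫⁻ z in D, ‖w y - w z‖ₑ ^ p)) := by
    intro y
    have m1 : Measurable fun x => ‖w x - w y‖ₑ ^ p := by fun_prop
    have m2 : Measurable fun z => ‖w y - w z‖ₑ ^ p := by fun_prop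
    calc pairEnergy p w A D
        ≤ ∫⁻ x in A, ∫⁻ z in D, 2 ^ (p - 1) * (‖w x - w y‖ₑ ^ p + ‖w y - w z‖ₑ ^ p) := by
          refine lintegral_mono fun x => lintegral_mono fun z => ?_
          refine le_trans ?_ (ENNReal.rpow_add_le_mul_rpow_add_rpow _ _ hp)
          refine ENNReal.rpow_le_rpow ?_ (by linarith)
          calc ‖w x - w z‖ₑ = ‖(w x - w y) + (w y - w z)‖ₑ := by rw [sub_add_sub_cancel]
            _ ≤ _ := enorm_add_le _ _
      _ = _ := by
          have hc : (2 : ℝ≥0∞) ^ (p - 1) ≠ ∞ := by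
            exact ENNReal.rpow_ne_top_of_nonneg (by linarith) (by simp)
          simp only [lintegral_const_mul' _ _ hc]
          congr 1
          calc _ = ∫⁻ x in A, (‖w x - w y‖ₑ ^ p * volume D + ∫⁻ z in D, ‖w y - w z‖ₑ ^ p) := by
                refine lintegral_congr fun x => ?_
                rw [lintegral_add_left measurable_const]
                simp
            _ = _ := by
                rw [lintegral_add_left (by fun_prop), lintegral_mul_const _ m1]
                simp [mul_comm]
  calc volume B * pairEnergy p w A D = ∫⁻ y in B, pairEnergy p w A D := by simp [mul_comm]
    _ ≤ ∫⁻ y in B, 2 ^ (p - 1) *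
      (volume D * (∫⁻ x in A, ‖w x - w y‖ₑ ^ p) +
        volume A * (∫⁻ z in D, ‖w y - w z‖ₑ ^ p)) := lintegral_mono fun y => h1 y
    _ = _ := by
      have m1 : Measurable fun y => ∫⁻ x in A, ‖w x - w y‖ₑ ^ p :=
        Measurable.lintegral_prod_left (f := fun x y => ‖w x - w y‖ₑ ^ p) hm
      have m2 : Measurable fun y => ∫⁻ z in D, ‖w y - w z‖ₑ ^ p :=
        hm.lintegral_prod_right
      rw [lintegral_const_mul _ (by fun_prop), lintegral_add_left (by fun_prop),
        lintegral_const_mul _ m1, lintegral_const_mul _ m2, pairEnergy_comm hw A B]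
      simp only [pairEnergy, enorm_sub_rev]

/-- In a connected open set the integral of `|w(x) - w(y)| ^ p` over any pair of sufficiently small
pieces is controlled by the integral over close pairs of points. -/
lemma exists_pairEnergy_le (hp : 1 ≤ p) (hΩo : IsOpen Ω) (hΩc : IsPreconnected Ω) {ρ r : ℝ}
    (hρ : 0 < ρ) (hr : 3 * ρ ≤ r) {x y : Euc d} (hx : x ∈ Ω) (hy : y ∈ Ω) :
    ∃ C : ℝ≥0, ∀ w : Euc d → ℂ, Measurable w →
      pairEnergy p w (Metric.ball x ρ ∩ Ω) (Metric.ball y ρ ∩ Ω) ≤ C * localEnergy p Ω r w := by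
  -- The relation between centres holds for nearby points and is transitive and symmetric, so on a
  -- preconnected set it holds for all pairs. Nearby means at distance below `ρ`: points of the two
  -- balls are then within `3 * ρ ≤ r`.
  refine hΩc.induction₂ (fun x y => ∃ C : ℝ≥0, ∀ w : Euc d → ℂ, Measurable w →
      pairEnergy p w (Metric.ball x ρ ∩ Ω) (Metric.ball y ρ ∩ Ω) ≤ C * localEnergy p Ω r w)
    ?_ ?_ ?_ hx hy
  · intro x hx
    filter_upwards [mem_nhdsWithin_of_mem_nhds (Metric.ball_mem_nhds x hρ)] with y hy
    refine ⟨1, fun w hw => ?_⟩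
    rw [ENNReal.coe_one, one_mul]
    refine pairEnergy_le_localEnergy hw Set.inter_subset_right Set.inter_subset_right ?_
    intro s hs t ht
    have h1 := Metric.mem_ball.1 hs.1
    have h2 := Metric.mem_ball.1 ht.1
    have h3 := Metric.mem_ball.1 hy
    have h4 := dist_triangle4 s x y t
    rw [dist_comm y t, dist_comm x y] at h4
    linarith
  · rintro x y z hx hy hz ⟨C, hC⟩ ⟨C', hC'⟩
    have hfin : ∀ x, volume (Metric.ball x ρ ∩ Ω) ≠ ∞ := fun x =>
      ((measure_mono Set.inter_subset_left).trans_lt Metric.isBounded_ball.measure_lt_top).ne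
    -- Openness of `Ω` lets `pairEnergy_triangle` be divided by the volume of the middle piece; `K`
    -- is the resulting constant.
    have hpos : volume (Metric.ball y ρ ∩ Ω) ≠ 0 :=
      ((Metric.isOpen_ball.inter hΩo).measure_pos _ ⟨y, Metric.mem_ball_self hρ, hy⟩).ne'
    have h2 : (2 : ℝ≥0∞) ^ (p - 1) ≠ ∞ := ENNReal.rpow_ne_top_of_nonneg (by linarith) (by simp)
    set V := volume (Metric.ball y ρ ∩ Ω)
    set K : ℝ≥0∞ := V⁻¹ * (2 ^ (p - 1) * (volume (Metric.ball z ρ ∩ Ω) * C +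
      volume (Metric.ball x ρ ∩ Ω) * C')) with hK
    have hKt : K ≠ ∞ := by
      refine ENNReal.mul_ne_top (ENNReal.inv_ne_top.2 hpos) (ENNReal.mul_ne_top h2
        (ENNReal.add_ne_top.2 ⟨ENNReal.mul_ne_top (hfin z) ENNReal.coe_ne_top,
          ENNReal.mul_ne_top (hfin x) ENNReal.coe_ne_top⟩))
    refine ⟨K.toNNReal, fun w hw => ?_⟩
    rw [ENNReal.coe_toNNReal hKt]
    have h := pairEnergy_triangle hp hw (Metric.ball x ρ ∩ Ω) (Metric.ball y ρ ∩ Ω)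
      (Metric.ball z ρ ∩ Ω)
    calc _ = V⁻¹ * (V * pairEnergy p w (Metric.ball x ρ ∩ Ω) (Metric.ball z ρ ∩ Ω)) := by
          rw [← mul_assoc, ENNReal.inv_mul_cancel hpos (hfin y), one_mul]
      _ ≤ V⁻¹ * (2 ^ (p - 1) * (volume (Metric.ball z ρ ∩ Ω) * (C * localEnergy p Ω r w) +
            volume (Metric.ball x ρ ∩ Ω) * (C' * localEnergy p Ω r w))) := by
          refine mul_le_mul_right (h.trans ?_) _
          gcongr
          exacts [hC w hw, hC' w hw]
      _ = _ := by rw [hK]; ring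
  · rintro x y hx hy ⟨C, hC⟩
    exact ⟨C, fun w hw => by rw [pairEnergy_comm hw]; exact hC w hw⟩

/-- A nonlocal Poincaré inequality. -/
lemma exists_pairEnergy_self_le (hp : 1 ≤ p) (hΩo : IsOpen Ω) (hΩc : IsPreconnected Ω)
    (hΩb : Bornology.IsBounded Ω) {r : ℝ} (hr : 0 < r) :
    ∃ C : ℝ≥0, ∀ w : Euc d → ℂ, Measurable w →
      pairEnergy p w Ω Ω ≤ C * localEnergy p Ω r w := by
  -- A finite `r / 3`-net with centres in `Ω`; its balls cut `Ω × Ω` into finitely many pairs of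
  -- pieces.
  obtain ⟨t, htΩ, htf, ht⟩ :=
    Metric.finite_approx_of_totallyBounded (hΩb.isCompact_closure.totallyBounded.subset subset_closure) (r / 3) (by positivity)
  choose! C hC using fun (x : Euc d) (hx : x ∈ Ω) (y : Euc d) (hy : y ∈ Ω) =>
    exists_pairEnergy_le (p := p) (r := r) hp hΩo hΩc (ρ := r / 3) (by positivity) (by linarith)
      hx hy
  have hcov : Ω ⊆ ⋃ x ∈ t, (Metric.ball x (r / 3) ∩ Ω) := fun x hx => by
    obtain ⟨y, hy, hxy⟩ := Set.mem_iUnion₂.1 (ht hx)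
    exact Set.mem_iUnion₂.2 ⟨y, hy, hxy, hx⟩
  lift t to Finset (Euc d) using htf
  refine ⟨∑ x ∈ t, ∑ y ∈ t, C x y, fun w hw => ?_⟩
  have hle : ∀ f : Euc d → ℝ≥0∞, ∫⁻ x in Ω, f x ≤
      ∑ x ∈ t, ∫⁻ y in Metric.ball x (r / 3) ∩ Ω, f y := by
    intro f
    rw [Set.biUnion_eq_iUnion] at hcov
    refine (lintegral_mono_set hcov).trans ((lintegral_iUnion_le _ _).trans_eq ?_)
    rw [tsum_fintype]
    exact Finset.sum_coe_sort t fun x => ∫⁻ y in Metric.ball x (r / 3) ∩ Ω, f y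
  push_cast
  simp only [Finset.sum_mul]
  calc pairEnergy p w Ω Ω
      ≤ ∑ x ∈ t, pairEnergy p w (Metric.ball x (r / 3) ∩ Ω) Ω := hle _
    _ = ∑ x ∈ t, pairEnergy p w Ω (Metric.ball x (r / 3) ∩ Ω) := by
        simp only [pairEnergy_comm hw]
    _ ≤ ∑ x ∈ t, ∑ y ∈ t,
        pairEnergy p w (Metric.ball y (r / 3) ∩ Ω) (Metric.ball x (r / 3) ∩ Ω) :=
        Finset.sum_le_sum fun x _ => hle _
    _ = ∑ x ∈ t, ∑ y ∈ t,
        pairEnergy p w (Metric.ball x (r / 3) ∩ Ω) (Metric.ball y (r / 3) ∩ Ω) :=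
        Finset.sum_comm
    _ ≤ _ := Finset.sum_le_sum fun x hx => Finset.sum_le_sum fun y hy =>
        hC x (htΩ hx) y (htΩ hy) w hw

end Poincare

/-! ### Mean values and `L_p` norms -/

section Average

variable {p : ℝ}

/-- The average is the integral against the normalized measure, for which the `L_1` norm is at most
the `L_p` norm. -/
lemma enorm_average_le {X : Type*} [MeasurableSpace X] {μ : Measure X} [IsFiniteMeasure μ]
    [NeZero μ] (hp : 1 ≤ p) {f : X → ℂ} (hf : AEStronglyMeasurable f μ) :
    ‖⨍ x, f x ∂μ‖ₑ ≤ (μ Set.univ)⁻¹ ^ (1 / p) * eLpNorm f (ENNReal.ofReal p) μ := by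
  have hV : (μ Set.univ)⁻¹ ≠ ∞ := ENNReal.inv_ne_top.2 (NeZero.ne _)
  have h1 : eLpNorm f 1 ((μ Set.univ)⁻¹ • μ) ≤
      eLpNorm f (ENNReal.ofReal p) ((μ Set.univ)⁻¹ • μ) :=
    eLpNorm_le_eLpNorm_of_exponent_le (by simpa using hp) (hf.mono_ac
      Measure.smul_absolutelyContinuous)
  rw [eLpNorm_smul_measure_of_ne_top (p := ENNReal.ofReal p) ENNReal.ofReal_ne_top,
    ENNReal.toReal_div, ENNReal.toReal_one, ENNReal.toReal_ofReal (by linarith), smul_eq_mul, eLpNorm_one_eq_lintegral_enorm] at h1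
  exact (enorm_integral_le_lintegral_enorm _).trans h1

lemma inv_rpow_mul_rpow_cancel {V : ℝ≥0∞} (h0 : V ≠ 0) (ht : V ≠ ∞) (q : ℝ) :
    V⁻¹ ^ q * V ^ q = 1 := by
  rw [ENNReal.inv_rpow]
  refine ENNReal.inv_mul_cancel ?_ ?_
  · simp [ENNReal.rpow_eq_zero_iff, h0, ht]
  · simp [ENNReal.rpow_eq_top_iff, h0, ht]

lemma eLpNorm_const_ofReal {X : Type*} [MeasurableSpace X] {μ : Measure X} [NeZero μ]
    (hp : 1 ≤ p) (c : ℂ) :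
    eLpNorm (fun _ : X => c) (ENNReal.ofReal p) μ = ‖c‖ₑ * (μ Set.univ) ^ (1 / p) := by
  rw [eLpNorm_const c (by simp; linarith) (NeZero.ne μ), ENNReal.toReal_ofReal (by linarith)]

/-- Up to a factor `2` the mean is the best constant: `f - ⟨f⟩ = (f - c) - ⟨f - c⟩`, and
`enorm_average_le` bounds the norm of the second term by that of the first. -/
lemma eLpNorm_sub_average_le {X : Type*} [MeasurableSpace X] {μ : Measure X} [IsFiniteMeasure μ]
    [NeZero μ] (hp : 1 ≤ p) {f : X → ℂ} (hf : MemLp f (ENNReal.ofReal p) μ) (c : ℂ) :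
    eLpNorm (fun x => f x - ⨍ y, f y ∂μ) (ENNReal.ofReal p) μ ≤
      2 * eLpNorm (fun x => f x - c) (ENNReal.ofReal p) μ := by
  have hp' : 1 ≤ ENNReal.ofReal p := by simpa using hp
  have hm : MemLp (fun x => f x - c) (ENNReal.ofReal p) μ := hf.sub (memLp_const c)
  have hi : Integrable f μ := hf.integrable hp'
  have hav : ⨍ x, (f x - c) ∂μ = ⨍ x, f x ∂μ - c := by
    rw [average_eq, average_eq, integral_sub hi (integrable_const c), smul_sub, integral_const,
      smul_smul, inv_mul_cancel₀, one_smul]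
    simp [Measure.real, ENNReal.toReal_eq_zero_iff, NeZero.ne]
  have h1 := enorm_average_le hp hm.1
  rw [hav] at h1
  have e : (fun x => f x - ⨍ y, f y ∂μ) =
      (fun x => f x - c) - fun _ => (⨍ y, f y ∂μ - c) := by
    ext x; simp
  rw [e, two_mul]
  refine (eLpNorm_sub_le hm.1 aestronglyMeasurable_const hp').trans ?_
  gcongr
  rw [eLpNorm_const_ofReal hp]
  calc _ ≤ ((μ Set.univ)⁻¹ ^ (1 / p) * eLpNorm (fun x => f x - c) (ENNReal.ofReal p) μ) *
        μ Set.univ ^ (1 / p) := by gcongr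
    _ = ((μ Set.univ)⁻¹ ^ (1 / p) * μ Set.univ ^ (1 / p)) *
        eLpNorm (fun x => f x - c) (ENNReal.ofReal p) μ := by ring
    _ = _ := by
      rw [inv_rpow_mul_rpow_cancel (NeZero.ne _) (measure_ne_top _ _), one_mul]

end Average

/-! ### The gauge controls the deviation from the mean -/

section Poincare

variable {d : ℕ} {Ω : Set (Euc d)} {a : Euc d → ℝ} {φ : ℝ → Euc d → Euc d → ℝ} {pm pp : ℝ}

/-- The energy controls the integral of `|w(x) - w(y)| ^ p₋` over close pairs of points. -/
lemma exists_localEnergy_le (hΩb : Bornology.IsBounded Ω) (ha : KernelConditions a)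
    (hφ : PhiConditions Ω φ pm pp) :
    ∃ r > 0, ∃ M : ℝ≥0, ∀ w : Euc d → ℂ, energy Ω a φ w ≤ 1 → localEnergy pm Ω r w ≤ M := by
  obtain ⟨C, hC⟩ := hφ.ae_isYoung
  obtain ⟨c, hc, r, hr, hac⟩ := ha.lower_bound
  have hfin : volume (Ω ×ˢ Ω) ≠ ∞ := (hΩb.prod hΩb).measure_lt_top.ne
  have hac' : ∀ᵐ z : Euc d × Euc d ∂(volume.restrict (Ω ×ˢ Ω)),
      z.1 - z.2 ∈ Metric.ball (0 : Euc d) r → c ≤ a (z.1 - z.2) := by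
    refine ae_restrict_of_ae ?_
    rw [Measure.volume_eq_prod]
    exact (quasiMeasurePreserving_sub volume volume).ae hac
  -- On close pairs `a ≥ c`, so the integrand is at most `1 + (C / c) φ a`: the `1` contributes at
  -- most the volume, the rest at most `C / c` because the energy is at most one.
  refine ⟨r, hr, (volume (Ω ×ˢ Ω)).toNNReal + Real.toNNReal (C / c), fun w hw => ?_⟩
  have hmT : MeasurableSet {z : Euc d × Euc d | dist z.1 z.2 < r} :=
    (isOpen_lt (by fun_prop) continuous_const).measurableSet
  calc localEnergy pm Ω r w
      ≤ ∫⁻ z in (Ω ×ˢ Ω) ∩ {z : Euc d × Euc d | dist z.1 z.2 < r},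
        (1 + ENNReal.ofReal (C / c) * ENNReal.ofReal (φ ‖w z.1 - w z.2‖ z.1 z.2 * a (z.1 - z.2)))
        := by
        refine lintegral_mono_ae ?_
        rw [Set.inter_comm, ← Measure.restrict_restrict hmT]
        filter_upwards [ae_restrict_of_ae hC, ae_restrict_of_ae hac', ae_restrict_mem hmT]
          with z h1 h2 h3
        have h4 : c ≤ a (z.1 - z.2) := h2 (by simpa [dist_eq_norm] using h3)
        have h5 := h1.2 _ (norm_nonneg (w z.1 - w z.2))
        have h6 := h1.1.nonneg _ (norm_nonneg (w z.1 - w z.2))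
        rw [← ofReal_norm, ENNReal.ofReal_rpow_of_nonneg (norm_nonneg _)
          (by linarith [hφ.one_lt]), ← ENNReal.ofReal_mul (by positivity), ← ENNReal.ofReal_one,
          ← ENNReal.ofReal_add zero_le_one (by have := ha.nonneg (z.1 - z.2); positivity)]
        refine ENNReal.ofReal_le_ofReal (h5.trans ?_)
        gcongr 1 + ?_
        calc _ = C / c * (φ ‖w z.1 - w z.2‖ z.1 z.2 * c) := by field_simp
          _ ≤ _ := by gcongr
    _ ≤ ∫⁻ z in (Ω ×ˢ Ω), (1 + ENNReal.ofReal (C / c) *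
        ENNReal.ofReal (φ ‖w z.1 - w z.2‖ z.1 z.2 * a (z.1 - z.2))) :=
        lintegral_mono_set Set.inter_subset_left
    _ = volume (Ω ×ˢ Ω) + ENNReal.ofReal (C / c) * energy Ω a φ w := by
        rw [lintegral_add_left measurable_const, lintegral_const_mul' _ _ ENNReal.ofReal_ne_top,
          energy]
        simp
    _ ≤ _ := by
        rw [ENNReal.coe_add, ENNReal.coe_toNNReal hfin]
        gcongr
        calc _ ≤ ENNReal.ofReal (C / c) * 1 := by gcongr
          _ = _ := by rw [mul_one]; rfl

/-- The pair energy is the integral over `y` of the `p`-th power of the `L_p` norm of `w - w y`;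
some `y` does no worse than average, and `c = w y` serves. -/
lemma exists_eLpNorm_sub_const_le {p : ℝ} (hp : 1 ≤ p) (hΩb : Bornology.IsBounded Ω)
    (hV : volume Ω ≠ 0) {w : Euc d → ℂ} (hw : Measurable w) {M : ℝ≥0}
    (hM : pairEnergy p w Ω Ω ≤ M) :
    ∃ c : ℂ, MemLp (fun x => w x - c) (ENNReal.ofReal p) (volume.restrict Ω) ∧
      eLpNorm (fun x => w x - c) (ENNReal.ofReal p) (volume.restrict Ω) ≤
      (M / volume Ω) ^ (1 / p) := by
  have hp0 : 0 < p := by linarith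
  have hV' : volume Ω ≠ ∞ := hΩb.measure_lt_top.ne
  have m1 : Measurable fun y => ∫⁻ x in Ω, ‖w y - w x‖ₑ ^ p :=
    (measurable_pair hw).lintegral_prod_right
  obtain ⟨y, -, hy⟩ := exists_le_setLAverage hV hV' m1.aemeasurable
  have hle : eLpNorm (fun x => w x - w y) (ENNReal.ofReal p) (volume.restrict Ω) ≤
      (M / volume Ω) ^ (1 / p) := by
    rw [eLpNorm_eq_lintegral_rpow_enorm_toReal (by simpa using hp0) ENNReal.ofReal_ne_top,
      ENNReal.toReal_ofReal hp0.le]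
    refine ENNReal.rpow_le_rpow ?_ (by positivity)
    simp only [enorm_sub_rev _ (w y)]
    refine hy.trans ?_
    rw [setLAverage_eq]
    gcongr
    exact hM
  refine ⟨w y, ⟨by fun_prop, hle.trans_lt ?_⟩, hle⟩
  exact ENNReal.rpow_lt_top_of_nonneg (by positivity)
    (ENNReal.div_ne_top ENNReal.coe_ne_top hV)

lemma neZero_restrict (hΩo : IsOpen Ω) (hΩn : Ω.Nonempty) : NeZero (volume.restrict Ω) :=
  ⟨by simpa using (hΩo.measure_pos volume hΩn).ne'⟩

lemma isFiniteMeasure_restrict (hΩb : Bornology.IsBounded Ω) :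
    IsFiniteMeasure (volume.restrict Ω) :=
  ⟨by simpa using hΩb.measure_lt_top⟩

/-- Functions with a finite gauge are in `L_{p₋}(Ω)`, and the gauge controls the deviation from the
mean value. -/
lemma exists_eLpNorm_sub_mean_le (hΩo : IsOpen Ω) (hΩc : IsConnected Ω)
    (hΩb : Bornology.IsBounded Ω) (ha : KernelConditions a) (hφ : PhiConditions Ω φ pm pp) :
    ∃ K : ℝ≥0, ∀ u : L1Loc Ω, orliczGauge Ω a φ u < ∞ →
      MemLp u (ENNReal.ofReal pm) (volume.restrict Ω) ∧
      eLpNorm (fun x => u x - mean u) (ENNReal.ofReal pm) (volume.restrict Ω) ≤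
        K * orliczGauge Ω a φ u := by
  have := neZero_restrict hΩo hΩc.nonempty
  have := isFiniteMeasure_restrict hΩb
  have hp : 1 ≤ pm := hφ.one_lt.le
  have hV : volume Ω ≠ 0 := (hΩo.measure_pos volume hΩc.nonempty).ne'
  obtain ⟨r, hr, M, hM⟩ := exists_localEnergy_le hΩb ha hφ
  obtain ⟨C, hC⟩ := exists_pairEnergy_self_le hp hΩo hΩc.isPreconnected hΩb hr
  set K₀ : ℝ≥0∞ := ((C * M : ℝ≥0) / volume Ω) ^ (1 / pm) with hK₀
  have hK₀t : K₀ ≠ ∞ := ENNReal.rpow_ne_top_of_nonneg (by positivity)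
    (ENNReal.div_ne_top ENNReal.coe_ne_top hV)
  -- `K₀` bounds the distance of `u / l` from a constant, rescaling gives the factor `l`, and
  -- passing to the mean costs `2`. The infimum over admissible `l` then gives the gauge.
  have key : ∀ u : L1Loc Ω, ∀ l : ℝ, 0 < l → energy Ω a φ (fun x => u x / (l : ℂ)) ≤ 1 →
      MemLp u (ENNReal.ofReal pm) (volume.restrict Ω) ∧
      eLpNorm (fun x => u x - mean u) (ENNReal.ofReal pm) (volume.restrict Ω) ≤
        2 * K₀ * ENNReal.ofReal l := by
    intro u l hl hE
    have hw : Measurable fun x => u x / (l : ℂ) := u.stronglyMeasurable.measurable.div_const _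
    obtain ⟨c, hcm, hc⟩ := exists_eLpNorm_sub_const_le hp hΩb hV hw (M := C * M)
      ((hC _ hw).trans (by rw [ENNReal.coe_mul]; gcongr; exact hM _ hE))
    have hl' : (l : ℂ) ≠ 0 := by exact_mod_cast hl.ne'
    have e : (fun x => u x - l * c) = (l : ℂ) • fun x => u x / (l : ℂ) - c := by
      ext x
      simp only [Pi.smul_apply, smul_eq_mul]
      field_simp
    have hum : MemLp u (ENNReal.ofReal pm) (volume.restrict Ω) := by
      have h1 : MemLp (fun x => u x - l * c) (ENNReal.ofReal pm) (volume.restrict Ω) := by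
        rw [e]; exact hcm.const_smul _
      exact (h1.add (memLp_const (l * c))).ae_eq (.of_forall fun x => by simp)
    refine ⟨hum, (eLpNorm_sub_average_le hp hum (l * c)).trans ?_⟩
    rw [e, eLpNorm_const_smul, mul_assoc, mul_comm K₀]
    gcongr
    rw [← ofReal_norm, Complex.norm_of_nonneg hl.le]
  refine ⟨(2 * K₀).toNNReal, fun u hu => ?_⟩
  rw [ENNReal.coe_toNNReal (ENNReal.mul_ne_top (by simp) hK₀t)]
  obtain ⟨l, hl, hE, -⟩ := exists_energy_le_of_orliczGauge_lt hu
  refine ⟨(key u l hl hE).1, ?_⟩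
  rcases eq_or_ne (2 * K₀) 0 with h0 | h0
  · simpa [h0] using (key u l hl hE).2
  rw [mul_comm, ← ENNReal.div_le_iff h0 (ENNReal.mul_ne_top (by simp) hK₀t)]
  refine le_sInf ?_
  rintro _ ⟨l, ⟨hl, hE⟩, rfl⟩
  rw [ENNReal.div_le_iff h0 (ENNReal.mul_ne_top (by simp) hK₀t), mul_comm]
  exact (key u l hl hE).2

end Poincare

/-! ### Mean-zero representatives of cosets -/

section Representatives

variable {d : ℕ} {Ω : Set (Euc d)} {a : Euc d → ℝ} {φ : ℝ → Euc d → Euc d → ℝ}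

lemma coeFn_perp (u : L1Loc Ω) : ∀ᵐ x ∂(volume.restrict Ω), perp u x = u x - mean u := by
  filter_upwards [L1Loc.coeFn_sub u (constFun Ω (mean u)), coeFn_constFun (mean u)] with x h1 h2
  rw [perp, h1, h2]

lemma orliczGauge_perp (u : L1Loc Ω) : orliczGauge Ω a φ (perp u) = orliczGauge Ω a φ u := by
  refine orliczGauge_congr a φ (c := -mean u) ?_
  filter_upwards [coeFn_perp u] with x hx
  rw [hx, sub_eq_add_neg]

lemma mean_congr {u v : Euc d → ℂ} (h : ∀ᵐ x ∂(volume.restrict Ω), u x = v x) :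
    ⨍ x in Ω, u x = ⨍ x in Ω, v x := average_congr h

lemma mean_add {u v : L1Loc Ω} (hu : Integrable u (volume.restrict Ω))
    (hv : Integrable v (volume.restrict Ω)) : mean (u + v) = mean u + mean v := by
  rw [mean, mean_congr (L1Loc.coeFn_add u v), average_eq, integral_add hu hv, smul_add,
    ← average_eq, ← average_eq, mean, mean]

lemma mean_smul (c : ℂ) (u : L1Loc Ω) : mean (c • u) = c * mean u := by
  rw [mean, mean_congr (L1Loc.coeFn_smul c u), average_eq, integral_const_mul, mean, average_eq,
    mul_smul_comm]

lemma mean_constFun [NeZero (volume.restrict Ω)] [IsFiniteMeasure (volume.restrict Ω)] (c : ℂ) :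
    mean (constFun Ω c) = c := by
  rw [mean, mean_congr (coeFn_constFun c), average_const]

lemma memLp_constFun [IsFiniteMeasure (volume.restrict Ω)] (q : ℝ≥0∞) (c : ℂ) :
    MemLp (constFun Ω c) q (volume.restrict Ω) :=
  (memLp_const c).ae_eq (by filter_upwards [coeFn_constFun (Ω := Ω) c] with x hx using hx.symm)

lemma L1Loc.memLp_add {q : ℝ≥0∞} {u v : L1Loc Ω} (hu : MemLp u q (volume.restrict Ω))
    (hv : MemLp v q (volume.restrict Ω)) :
    MemLp (u + v : L1Loc Ω) q (volume.restrict Ω) :=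
  (hu.add hv).ae_eq (by filter_upwards [L1Loc.coeFn_add u v] with x hx using hx.symm)

lemma L1Loc.memLp_smul {q : ℝ≥0∞} {u : L1Loc Ω} (c : ℂ) (hu : MemLp u q (volume.restrict Ω)) :
    MemLp (c • u : L1Loc Ω) q (volume.restrict Ω) :=
  (hu.const_smul c).ae_eq (by filter_upwards [L1Loc.coeFn_smul c u] with x hx using hx.symm)

lemma perp_eq_add (u : L1Loc Ω) : perp u = u + constFun Ω (-mean u) := by
  rw [perp, map_neg, sub_eq_add_neg]

lemma memLp_perp [IsFiniteMeasure (volume.restrict Ω)] {q : ℝ≥0∞} {u : L1Loc Ω}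
    (hu : MemLp u q (volume.restrict Ω)) : MemLp (perp u) q (volume.restrict Ω) := by
  rw [perp_eq_add]
  exact L1Loc.memLp_add hu (memLp_constFun q _)

lemma mean_perp [NeZero (volume.restrict Ω)] [IsFiniteMeasure (volume.restrict Ω)] {u : L1Loc Ω}
    (hu : Integrable u (volume.restrict Ω)) : mean (perp u) = 0 := by
  rw [perp_eq_add, mean_add hu (memLp_one_iff_integrable.1 (memLp_constFun 1 _)), mean_constFun,
    add_neg_cancel]

lemma memLp_loc {q : ℝ≥0∞} {u : Euc d →ₘ[volume.restrict Ω] ℂ}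
    (hu : MemLp u q (volume.restrict Ω)) : u ∈ LpLoc Ω q := fun _ hK _ =>
  hu.mono_measure (Measure.restrict_mono hK le_rfl)

lemma coset_perp (u : L1Loc Ω) : coset (perp u) = coset u := by
  rw [coset, coset, Submodule.Quotient.eq, perp_eq_add, add_sub_cancel_left]
  exact ⟨_, rfl⟩

end Representatives

/-! ### Lower semicontinuity and completeness of the gauge -/

section Completeness

variable {d : ℕ} {Ω : Set (Euc d)} {a : Euc d → ℝ} {φ : ℝ → Euc d → Euc d → ℝ} {pm pp : ℝ}

/-- Admissible `l` form an upward closed set, so any number strictly above the gauge is itself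
admissible. -/
lemma energy_div_anti (ha : KernelConditions a) (hφ : PhiConditions Ω φ pm pp) (u : Euc d → ℂ)
    {l m : ℝ} (hl : 0 < l) (hlm : l ≤ m) :
    energy Ω a φ (fun x => u x / (m : ℂ)) ≤ energy Ω a φ (fun x => u x / (l : ℂ)) := by
  obtain ⟨C, hC⟩ := hφ.ae_isYoung
  refine lintegral_mono_ae ?_
  filter_upwards [hC] with z hz
  refine ENNReal.ofReal_le_ofReal (mul_le_mul_of_nonneg_right ?_ (ha.nonneg _))
  refine hz.1.mono (norm_nonneg _) ?_
  rw [← sub_div, ← sub_div, norm_div, norm_div, Complex.norm_of_nonneg hl.le,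
    Complex.norm_of_nonneg (hl.le.trans hlm)]
  gcongr

/-- Lower semicontinuity of the gauge with respect to convergence almost everywhere. -/
lemma orliczGauge_le_of_tendsto (ha : KernelConditions a) (hφ : PhiConditions Ω φ pm pp)
    {v : ℕ → L1Loc Ω} {w : L1Loc Ω} {ε : ℝ} (hε : 0 < ε)
    (hv : ∀ᶠ n in atTop, orliczGauge Ω a φ (v n) < ENNReal.ofReal ε)
    (hlim : ∀ᵐ x ∂(volume.restrict Ω), Tendsto (fun n => v n x) atTop (𝓝 (w x))) :
    orliczGauge Ω a φ w ≤ ENNReal.ofReal ε := by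
  obtain ⟨C, hC⟩ := hφ.ae_isYoung
  refine orliczGauge_le_of_energy_le hε ?_
  have h1 : ∀ᶠ n in atTop, energy Ω a φ (fun x => v n x / (ε : ℂ)) ≤ 1 := by
    filter_upwards [hv] with n hn
    obtain ⟨l, hl, hE, hle⟩ := exists_energy_le_of_orliczGauge_lt hn
    exact (energy_div_anti ha hφ _ hl ((ENNReal.ofReal_lt_ofReal_iff hε).1 hle).le).trans hE
  -- Fatou's lemma, with lower semicontinuity of Young functions inside the integral.
  calc energy Ω a φ (fun x => w x / (ε : ℂ))
      ≤ ∫⁻ z in Ω ×ˢ Ω, liminf (fun n => ENNReal.ofReal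
        (φ ‖v n z.1 / (ε : ℂ) - v n z.2 / (ε : ℂ)‖ z.1 z.2 * a (z.1 - z.2))) atTop := by
        refine lintegral_mono_ae ?_
        filter_upwards [hC, ae_restrict_prod hlim] with z h1 h2
        exact h1.1.ofReal_le_liminf (norm_nonneg _)
          ((h2.1.div_const _).sub (h2.2.div_const _)).norm
    _ ≤ liminf (fun n => energy Ω a φ (fun x => v n x / (ε : ℂ))) atTop :=
        lintegral_liminf_le' fun n => aemeasurable_energy_integrand ha hφ (v n) ε
    _ ≤ 1 := liminf_le_of_frequently_le' h1.frequently

lemma perp_sub {u v : L1Loc Ω} (hu : Integrable u (volume.restrict Ω))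
    (hv : Integrable v (volume.restrict Ω)) : perp (u - v) = perp u - perp v := by
  have h : mean (u - v) = mean u - mean v := by
    have h1 : mean (u - v) + mean v = mean u := by
      rw [← mean_add _ hv, sub_add_cancel]
      exact (hu.sub hv).congr (by filter_upwards [L1Loc.coeFn_sub u v] with x hx using hx.symm)
    rw [← h1, add_sub_cancel_right]
  rw [perp, perp, perp, h, map_sub]
  abel

/-- Completeness of the gauge on `L_{1,loc}(Ω)`. -/
lemma exists_limit_of_cauchy (hΩo : IsOpen Ω) (hΩc : IsConnected Ω)
    (hΩb : Bornology.IsBounded Ω) (ha : KernelConditions a) (hφ : PhiConditions Ω φ pm pp)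
    {u : ℕ → L1Loc Ω} (hu : ∀ n, orliczGauge Ω a φ (u n) < ∞)
    (hC : ∀ ε : ℝ, 0 < ε → ∃ N, ∀ n ≥ N, ∀ m ≥ N,
      orliczGauge Ω a φ (u n - u m : L1Loc Ω) < ENNReal.ofReal ε) :
    ∃ v : L1Loc Ω, ∀ ε : ℝ, 0 < ε → ∃ N, ∀ n ≥ N,
      orliczGauge Ω a φ (u n - v : L1Loc Ω) ≤ ENNReal.ofReal ε := by
  have := neZero_restrict hΩo hΩc.nonempty
  have := isFiniteMeasure_restrict hΩb
  have hp' : 1 ≤ ENNReal.ofReal pm := by simpa using hφ.one_lt.le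
  have : Fact (1 ≤ ENNReal.ofReal pm) := ⟨hp'⟩
  obtain ⟨K, hK⟩ := exists_eLpNorm_sub_mean_le hΩo hΩc hΩb ha hφ
  have hmem : ∀ n, MemLp (u n) (ENNReal.ofReal pm) (volume.restrict Ω) := fun n =>
    (hK _ (hu n)).1
  have hint : ∀ n, Integrable (u n) (volume.restrict Ω) := fun n => (hmem n).integrable hp'
  have hw : ∀ n, MemLp (perp (u n)) (ENNReal.ofReal pm) (volume.restrict Ω) := fun n =>
    memLp_perp (hmem n)
  -- Removing means does not change the gauge of differences, but makes the sequence Cauchy in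
  -- `L_{p₋}` by the Poincaré inequality.
  have hgauge : ∀ n m, orliczGauge Ω a φ (perp (u n) - perp (u m) : L1Loc Ω) =
      orliczGauge Ω a φ (u n - u m : L1Loc Ω) := fun n m => by
    rw [← perp_sub (hint n) (hint m), orliczGauge_perp]
  have hle : ∀ n m, orliczGauge Ω a φ (u n - u m : L1Loc Ω) < ∞ →
      eLpNorm (⇑(perp (u n)).toAE - ⇑(perp (u m)).toAE) (ENNReal.ofReal pm) (volume.restrict Ω) ≤
      K * orliczGauge Ω a φ (u n - u m : L1Loc Ω) := by
    intro n m h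
    refine (eLpNorm_congr_ae ?_).trans_le (hK _ h).2
    have e := perp_sub (hint n) (hint m)
    filter_upwards [L1Loc.coeFn_sub (perp (u n)) (perp (u m)), coeFn_perp (u n - u m)]
      with x h1 h2
    rw [Pi.sub_apply, ← h1, ← e, h2]
  set f : ℕ → Lp ℂ (ENNReal.ofReal pm) (volume.restrict Ω) := fun n => (hw n).toLp _ with hf
  have hcau : CauchySeq f := by
    refine Metric.cauchySeq_iff'.2 fun ε hε => ?_
    -- The denominator `K + 1` allows `K = 0` and makes the final inequality strict.
    obtain ⟨N, hN⟩ := hC (ε / (K + 1)) (by positivity)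
    refine ⟨N, fun n hn => ?_⟩
    have h1 := hN n hn N le_rfl
    have h2 := hle n N (h1.trans ENNReal.ofReal_lt_top)
    have hlt : edist (f n) (f N) < ENNReal.ofReal ε := by
      rw [hf, Lp.edist_toLp_toLp]
      refine h2.trans_lt ?_
      calc K * orliczGauge Ω a φ (u n - u N : L1Loc Ω)
          ≤ K * ENNReal.ofReal (ε / (K + 1)) := by gcongr
        _ = ENNReal.ofReal (K * (ε / (K + 1))) := by
            rw [ENNReal.ofReal_mul K.coe_nonneg, ENNReal.ofReal_coe_nnreal]
        _ < ENNReal.ofReal ε := by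
            rw [ENNReal.ofReal_lt_ofReal_iff hε, ← mul_div_assoc, div_lt_iff₀ (by positivity)]
            nlinarith
    rwa [edist_lt_ofReal] at hlt
  obtain ⟨g, hg⟩ := cauchySeq_tendsto_of_complete hcau
  obtain ⟨ns, hns, hlim⟩ := (tendstoInMeasure_of_tendsto_Lp hg).exists_seq_tendsto_ae
  set v : L1Loc Ω := ⟨g.1, LpLoc_le_L1Loc Ω hp' (memLp_loc (Lp.memLp g))⟩ with hv
  have hlim' : ∀ᵐ x ∂(volume.restrict Ω),
      Tendsto (fun k => perp (u (ns k)) x) atTop (𝓝 (v x)) := by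
    filter_upwards [hlim, ae_all_iff.2 fun n => (hw n).coeFn_toLp] with x h1 h2
    simp only [hf, h2] at h1
    exact h1
  refine ⟨v, fun ε hε => ?_⟩
  obtain ⟨N, hN⟩ := hC ε hε
  refine ⟨N, fun n hn => ?_⟩
  have h1 : orliczGauge Ω a φ (u n - v : L1Loc Ω) =
      orliczGauge Ω a φ (perp (u n) - v : L1Loc Ω) := by
    refine orliczGauge_congr a φ (c := mean (u n)) ?_
    filter_upwards [L1Loc.coeFn_sub (u n) v, L1Loc.coeFn_sub (perp (u n)) v, coeFn_perp (u n)]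
      with x h1 h2 h3
    rw [h1, h2, h3]
    ring
  rw [h1]
  -- With `n` fixed, the subsequence index goes to infinity; `ns k ≥ k ≥ N` keeps the Cauchy bound
  -- valid.
  refine orliczGauge_le_of_tendsto (v := fun k => perp (u n) - perp (u (ns k))) ha hφ hε ?_ ?_
  · filter_upwards [eventually_ge_atTop N] with k hk
    rw [hgauge]
    exact hN n hn _ (hk.trans (hns.id_le k))
  · filter_upwards [hlim', L1Loc.coeFn_sub (perp (u n)) v,
      ae_all_iff.2 fun k => L1Loc.coeFn_sub (perp (u n)) (perp (u (ns k)))] with x h1 h2 h3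
    simp only [h2, h3]
    exact tendsto_const_nhds.sub h1

end Completeness

/-! ### The spaces `Λ(Ω)` and `𝓛(Ω)` -/

section Spaces

variable {d : ℕ} {Ω : Set (Euc d)} {a : Euc d → ℝ} {φ : ℝ → Euc d → Euc d → ℝ} {pm pp : ℝ}

lemma cosetGauge_add_le (ha : KernelConditions a) (hφ : PhiConditions Ω φ pm pp)
    (U V : Coset Ω) :
    cosetGauge Ω a φ (U + V) ≤ cosetGauge Ω a φ U + cosetGauge Ω a φ V := by
  induction U using Submodule.Quotient.induction_on with | _ u
  induction V using Submodule.Quotient.induction_on with | _ v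
  exact orliczGauge_add_le ha hφ u v

lemma cosetGauge_smul (hφ : PhiConditions Ω φ pm pp) (c : ℂ) (U : Coset Ω) :
    cosetGauge Ω a φ (c • U) = ‖c‖ₑ * cosetGauge Ω a φ U := by
  induction U using Submodule.Quotient.induction_on with | _ u
  exact orliczGauge_smul hφ c u

lemma cosetGauge_zero (hφ : PhiConditions Ω φ pm pp) : cosetGauge Ω a φ 0 = 0 := by
  simpa using cosetGauge_smul (a := a) hφ 0 0

/-- The linear space `Λ(Ω)` of the cosets with a finite gauge. -/
def cosetSubmodule (ha : KernelConditions a) (hφ : PhiConditions Ω φ pm pp) :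
    Submodule ℂ (Coset Ω) where
  carrier := cosetSpace Ω a φ
  zero_mem' := by
    change cosetGauge Ω a φ 0 < ∞
    rw [cosetGauge_zero hφ]
    exact ENNReal.zero_lt_top
  add_mem' {U V} hU hV := (cosetGauge_add_le ha hφ U V).trans_lt (ENNReal.add_lt_top.2 ⟨hU, hV⟩)
  smul_mem' c U hU := by
    change cosetGauge Ω a φ (c • U) < ∞
    rw [cosetGauge_smul hφ]
    exact ENNReal.mul_lt_top enorm_lt_top hU

lemma mem_cosetSubmodule {ha : KernelConditions a} {hφ : PhiConditions Ω φ pm pp}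
    {u : L1Loc Ω} : coset u ∈ cosetSubmodule ha hφ ↔ orliczGauge Ω a φ u < ∞ := Iff.rfl

/-- Finiteness of the norm already gives global, hence local, `p₋`-integrability, since classes have
measurable representatives. -/
lemma mem_fullSpace {u : L1Loc Ω} : u ∈ fullSpace Ω a φ pm ↔
    orliczGauge Ω a φ u < ∞ ∧ MemLp u (ENNReal.ofReal pm) (volume.restrict Ω) := by
  constructor
  · rintro ⟨-, h⟩
    obtain ⟨h1, h2⟩ := ENNReal.add_lt_top.1 h
    exact ⟨h1, u.stronglyMeasurable.aestronglyMeasurable, h2⟩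
  · rintro ⟨h1, h2⟩
    exact ⟨memLp_loc h2, ENNReal.add_lt_top.2 ⟨h1, h2.2⟩⟩

/-- The linear space `𝓛(Ω)`. -/
def fullSubmodule (ha : KernelConditions a) (hφ : PhiConditions Ω φ pm pp) :
    Submodule ℂ (L1Loc Ω) where
  carrier := fullSpace Ω a φ pm
  zero_mem' := by
    refine mem_fullSpace.2 ⟨?_, ?_⟩
    · rw [orliczGauge_eq_zero_of_ae_eq_const hφ L1Loc.coeFn_zero]
      exact ENNReal.zero_lt_top
    · exact MemLp.zero.ae_eq
        (by filter_upwards [L1Loc.coeFn_zero (Ω := Ω)] with x hx using hx.symm)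
  add_mem' {u v} hu hv := by
    obtain ⟨hu1, hu2⟩ := mem_fullSpace.1 hu
    obtain ⟨hv1, hv2⟩ := mem_fullSpace.1 hv
    exact mem_fullSpace.2 ⟨(orliczGauge_add_le ha hφ u v).trans_lt
      (ENNReal.add_lt_top.2 ⟨hu1, hv1⟩), L1Loc.memLp_add hu2 hv2⟩
  smul_mem' c u hu := by
    obtain ⟨hu1, hu2⟩ := mem_fullSpace.1 hu
    exact mem_fullSpace.2 ⟨(orliczGauge_smul_le hφ c u).trans_lt
      (ENNReal.mul_lt_top enorm_lt_top hu1), L1Loc.memLp_smul c hu2⟩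

lemma mem_fullSubmodule {ha : KernelConditions a} {hφ : PhiConditions Ω φ pm pp} {u : L1Loc Ω} :
    u ∈ fullSubmodule ha hφ ↔
      orliczGauge Ω a φ u < ∞ ∧ MemLp u (ENNReal.ofReal pm) (volume.restrict Ω) :=
  mem_fullSpace

/-- By the Poincaré inequality a function of zero gauge equals its mean a.e. -/
lemma coset_eq_zero_of_gauge_eq_zero (hΩo : IsOpen Ω) (hΩc : IsConnected Ω)
    (hΩb : Bornology.IsBounded Ω) (ha : KernelConditions a) (hφ : PhiConditions Ω φ pm pp)
    {U : Coset Ω} (hU : cosetGauge Ω a φ U = 0) : U = 0 := by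
  induction U using Submodule.Quotient.induction_on with | _ u
  have hU' : orliczGauge Ω a φ u = 0 := hU
  obtain ⟨K, hK⟩ := exists_eLpNorm_sub_mean_le hΩo hΩc hΩb ha hφ
  obtain ⟨h1, h2⟩ := hK u (by rw [hU']; exact ENNReal.zero_lt_top)
  rw [hU', mul_zero, nonpos_iff_eq_zero] at h2
  replace h2 := (eLpNorm_eq_zero_iff (h1.1.sub aestronglyMeasurable_const)
    (by simpa using zero_lt_one.trans hφ.one_lt)).1 h2
  refine (Submodule.Quotient.mk_eq_zero _).2 ⟨mean u, L1Loc.ext ?_⟩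
  filter_upwards [h2, coeFn_constFun (Ω := Ω) (mean u)] with x hx hc
  rw [hc]
  exact (sub_eq_zero.1 hx).symm

lemma isBanachUnder_cosetGauge (hΩo : IsOpen Ω) (hΩc : IsConnected Ω)
    (hΩb : Bornology.IsBounded Ω) (ha : KernelConditions a) (hφ : PhiConditions Ω φ pm pp) :
    IsBanachUnder (cosetSubmodule ha hφ) (cosetGauge Ω a φ) := by
  have hfin : ∀ v ∈ cosetSubmodule ha hφ, cosetGauge Ω a φ v < ∞ := fun v hv => hv
  refine ⟨hfin, ?_⟩
  let _ : Norm (cosetSubmodule ha hφ) := ⟨fun v => (cosetGauge Ω a φ v).toReal⟩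
  have core : NormedSpace.Core ℂ (cosetSubmodule ha hφ) :=
    { norm_nonneg := fun v => ENNReal.toReal_nonneg
      norm_smul := fun c v => by
        change (cosetGauge Ω a φ (c • (v : Coset Ω))).toReal = _
        rw [cosetGauge_smul hφ, ENNReal.toReal_mul, toReal_enorm]
        rfl
      norm_triangle := fun v w => by
        change (cosetGauge Ω a φ ((v : Coset Ω) + w)).toReal ≤
          (cosetGauge Ω a φ (v : Coset Ω)).toReal + (cosetGauge Ω a φ (w : Coset Ω)).toReal
        rw [← ENNReal.toReal_add (hfin _ v.2).ne (hfin _ w.2).ne]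
        exact ENNReal.toReal_mono (ENNReal.add_lt_top.2 ⟨hfin _ v.2, hfin _ w.2⟩).ne
          (cosetGauge_add_le ha hφ _ _)
      norm_eq_zero_iff := fun v => by
        change (cosetGauge Ω a φ (v : Coset Ω)).toReal = 0 ↔ _
        rw [ENNReal.toReal_eq_zero_iff, or_iff_left (hfin _ v.2).ne]
        refine ⟨fun h => Subtype.ext (coset_eq_zero_of_gauge_eq_zero hΩo hΩc hΩb ha hφ h), ?_⟩
        rintro rfl
        exact cosetGauge_zero hφ }
  refine ⟨core, ?_⟩
  let _ : NormedAddCommGroup (cosetSubmodule ha hφ) := NormedAddCommGroup.ofCore core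
  have hnorm : ∀ v : cosetSubmodule ha hφ, ‖v‖ = (cosetGauge Ω a φ v).toReal := fun v => rfl
  refine Metric.complete_of_cauchySeq_tendsto fun U hU => ?_
  choose u hu using fun n => Submodule.Quotient.mk_surjective _ (U n : Coset Ω)
  have hug : ∀ n, orliczGauge Ω a φ (u n) < ∞ := fun n => by
    rw [← mem_cosetSubmodule (ha := ha) (hφ := hφ), coset, hu]
    exact (U n).2
  obtain ⟨v, hv⟩ := exists_limit_of_cauchy hΩo hΩc hΩb ha hφ hug fun ε hε => by
    obtain ⟨N, hN⟩ := Metric.cauchySeq_iff.1 hU ε hε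
    refine ⟨N, fun n hn m hm => ?_⟩
    have h := hN n hn m hm
    rw [dist_eq_norm, hnorm, AddSubgroupClass.coe_sub, ← hu, ← hu] at h
    have hmem := (cosetSubmodule ha hφ).sub_mem (U n).2 (U m).2
    rw [← hu, ← hu] at hmem
    exact (ENNReal.lt_ofReal_iff_toReal_lt (hfin _ hmem).ne).2 h
  have hsub : ∀ n, cosetGauge Ω a φ ((U n : Coset Ω) - coset v) =
      orliczGauge Ω a φ (u n - v : L1Loc Ω) := fun n => by rw [← hu]; rfl
  -- The limit is the difference of `U N` and `U N - coset v`, both of finite gauge.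
  have hvmem : coset v ∈ cosetSubmodule ha hφ := by
    obtain ⟨N, hN⟩ := hv 1 one_pos
    have h : (U N : Coset Ω) - coset v ∈ cosetSubmodule ha hφ := by
      change cosetGauge Ω a φ _ < ∞
      rw [hsub]
      exact (hN N le_rfl).trans_lt ENNReal.ofReal_lt_top
    simpa using (cosetSubmodule ha hφ).sub_mem (U N).2 h
  refine ⟨⟨coset v, hvmem⟩, Metric.tendsto_atTop.2 fun ε hε => ?_⟩
  obtain ⟨N, hN⟩ := hv (ε / 2) (by positivity)
  refine ⟨N, fun n hn => ?_⟩
  rw [dist_eq_norm, hnorm, AddSubgroupClass.coe_sub, hsub]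
  exact (ENNReal.toReal_le_of_le_ofReal (by positivity) (hN n hn)).trans_lt (by linarith)

/-- Each coset with a finite gauge has a unique representative in `L_{p₋}(Ω)` with a given mean
value. -/
lemma existsUnique_representative (hΩo : IsOpen Ω) (hΩc : IsConnected Ω)
    (hΩb : Bornology.IsBounded Ω) (ha : KernelConditions a) (hφ : PhiConditions Ω φ pm pp)
    {U : Coset Ω} (hU : U ∈ cosetSubmodule ha hφ) (c : ℂ) :
    ∃! u : L1Loc Ω, coset u = U ∧
      MemLp u (ENNReal.ofReal pm) (volume.restrict Ω) ∧ mean u = c := by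
  have := neZero_restrict hΩo hΩc.nonempty
  have := isFiniteMeasure_restrict hΩb
  have hp' : 1 ≤ ENNReal.ofReal pm := by simpa using hφ.one_lt.le
  obtain ⟨K, hK⟩ := exists_eLpNorm_sub_mean_le hΩo hΩc hΩb ha hφ
  have hconst : ∀ c, Integrable (constFun Ω c) (volume.restrict Ω) := fun c =>
    memLp_one_iff_integrable.1 (memLp_constFun 1 c)
  induction U using Submodule.Quotient.induction_on with | _ u
  have hu := (hK u hU).1
  refine ⟨perp u + constFun Ω c, ⟨?_, L1Loc.memLp_add (memLp_perp hu) (memLp_constFun _ _), ?_⟩, ?_⟩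
  · refine Eq.trans ?_ (coset_perp u)
    rw [coset, coset, Submodule.Quotient.eq, add_sub_cancel_left]
    exact ⟨_, rfl⟩
  · rw [mean_add ((memLp_perp hu).integrable hp') (hconst c), mean_perp (hu.integrable hp'),
      mean_constFun, zero_add]
  · rintro v ⟨hv1, -, hv3⟩
    obtain ⟨b, hb⟩ := (Submodule.Quotient.eq _).1 hv1
    -- Representatives differ by a constant `b`, and the prescribed mean determines `b`.
    have e : v = u + constFun Ω b := by rw [hb]; abel
    have h : mean u + b = c := by
      rw [← hv3, e, mean_add (hu.integrable hp') (hconst b), mean_constFun]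
    rw [e, perp_eq_add, ← h, add_assoc, ← map_add, neg_add_cancel_left]

/-- The linear isomorphism of `𝓛(Ω)` onto `Λ(Ω) × ℂ`. -/
lemma exists_linearEquiv (hΩo : IsOpen Ω) (hΩc : IsConnected Ω)
    (hΩb : Bornology.IsBounded Ω) (ha : KernelConditions a) (hφ : PhiConditions Ω φ pm pp) :
    ∃ T : fullSubmodule ha hφ ≃ₗ[ℂ] (cosetSubmodule ha hφ × ℂ), ∀ u : fullSubmodule ha hφ,
      ((T u).1 : Coset Ω) = coset (u : L1Loc Ω) ∧ (T u).2 = mean (u : L1Loc Ω) := by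
  have := isFiniteMeasure_restrict hΩb
  have hp' : 1 ≤ ENNReal.ofReal pm := by simpa using hφ.one_lt.le
  have hint : ∀ u : fullSubmodule ha hφ, Integrable (u : L1Loc Ω) (volume.restrict Ω) :=
    fun u => (mem_fullSubmodule.1 u.2).2.integrable hp'
  let T₀ : fullSubmodule ha hφ →ₗ[ℂ] (cosetSubmodule ha hφ × ℂ) :=
    { toFun := fun u => (⟨coset (u : L1Loc Ω), (mem_fullSubmodule.1 u.2).1⟩, mean (u : L1Loc Ω))
      map_add' := fun u v => Prod.ext (Subtype.ext rfl) (mean_add (hint u) (hint v))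
      map_smul' := fun c u => Prod.ext (Subtype.ext rfl) (mean_smul c _) }
  refine ⟨LinearEquiv.ofBijective T₀ ⟨?_, ?_⟩, fun u => ⟨rfl, rfl⟩⟩
  · intro u v huv
    have h1 : coset (u : L1Loc Ω) = coset (v : L1Loc Ω) :=
      congrArg (fun z : cosetSubmodule ha hφ × ℂ => (z.1 : Coset Ω)) huv
    have h2 : mean (u : L1Loc Ω) = mean (v : L1Loc Ω) := congrArg Prod.snd huv
    -- A coset and a mean value determine the function; the existence half, with arbitrary mean `c`,
    -- gives surjectivity below.
    exact Subtype.ext ((existsUnique_representative hΩo hΩc hΩb ha hφ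
      (mem_fullSubmodule.1 v.2).1 (mean (v : L1Loc Ω))).unique
      ⟨h1, (mem_fullSubmodule.1 u.2).2, h2⟩ ⟨rfl, (mem_fullSubmodule.1 v.2).2, rfl⟩)
  · rintro ⟨U, c⟩
    obtain ⟨u, ⟨hu1, hu2, hu3⟩, -⟩ := existsUnique_representative hΩo hΩc hΩb ha hφ U.2 c
    have hmem : u ∈ fullSubmodule ha hφ := by
      refine mem_fullSubmodule.2 ⟨?_, hu2⟩
      rw [← mem_cosetSubmodule (ha := ha) (hφ := hφ), hu1]
      exact U.2
    exact ⟨⟨u, hmem⟩, Prod.ext (Subtype.ext hu1) hu3⟩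

/-- The equivalence of the norms of `𝓛(Ω)` and `Λ(Ω) × ℂ`. -/
lemma exists_equivalent_norms (hΩo : IsOpen Ω) (hΩc : IsConnected Ω)
    (hΩb : Bornology.IsBounded Ω) (ha : KernelConditions a) (hφ : PhiConditions Ω φ pm pp) :
    ∃ c₃ c₄ : ℝ≥0, 0 < c₃ ∧ 0 < c₄ ∧ ∀ u ∈ fullSubmodule ha hφ,
      (c₃ : ℝ≥0∞) * (orliczGauge Ω a φ (perp u) + ‖mean u‖ₑ) ≤ fullNorm Ω a φ pm u ∧
      fullNorm Ω a φ pm u ≤ (c₄ : ℝ≥0∞) * (orliczGauge Ω a φ (perp u) + ‖mean u‖ₑ) := by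
  have := neZero_restrict hΩo hΩc.nonempty
  have := isFiniteMeasure_restrict hΩb
  have hp : 1 ≤ pm := hφ.one_lt.le
  have hp' : 1 ≤ ENNReal.ofReal pm := by simpa using hp
  obtain ⟨K, hK⟩ := exists_eLpNorm_sub_mean_le hΩo hΩc hΩb ha hφ
  set V : ℝ≥0∞ := volume.restrict Ω Set.univ with hV
  have hV0 : V ≠ 0 := NeZero.ne _
  have hVt : V ≠ ∞ := measure_ne_top _ _
  obtain ⟨A, hA⟩ : ∃ A : ℝ≥0, (A : ℝ≥0∞) = V⁻¹ ^ (1 / pm) := ⟨_, ENNReal.coe_toNNReal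
    (ENNReal.rpow_ne_top_of_nonneg (by positivity) (ENNReal.inv_ne_top.2 hV0))⟩
  obtain ⟨B, hB⟩ : ∃ B : ℝ≥0, (B : ℝ≥0∞) = V ^ (1 / pm) := ⟨_, ENNReal.coe_toNNReal
    (ENNReal.rpow_ne_top_of_nonneg (by positivity) hVt)⟩
  -- `A` bounds the mean by the `L_{p₋}` norm, `K` is the Poincaré constant, and `B` is the `L_{p₋}`
  -- norm of the constant `1`.
  refine ⟨(1 + A)⁻¹, 1 + K + B, by positivity, by positivity, fun u hu => ?_⟩
  obtain ⟨hu1, hu2⟩ := mem_fullSubmodule.1 hu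
  rw [orliczGauge_perp, fullNorm]
  set g := orliczGauge Ω a φ u
  constructor
  · rw [ENNReal.coe_inv (by positivity), mul_comm, ← div_eq_mul_inv]
    refine ENNReal.div_le_of_le_mul ?_
    have h : ‖mean u‖ₑ ≤ A * eLpNorm u (ENNReal.ofReal pm) (volume.restrict Ω) := by
      rw [hA]; exact enorm_average_le hp hu2.1
    push_cast
    calc g + ‖mean u‖ₑ
        ≤ g + A * eLpNorm u (ENNReal.ofReal pm) (volume.restrict Ω) := by gcongr
      -- The added terms complete the product of `1 + A` with the full norm.
      _ ≤ (g + A * eLpNorm u (ENNReal.ofReal pm) (volume.restrict Ω)) +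
          (A * g + eLpNorm u (ENNReal.ofReal pm) (volume.restrict Ω)) := le_self_add
      _ = _ := by ring
  · have h : eLpNorm u (ENNReal.ofReal pm) (volume.restrict Ω) ≤ K * g + ‖mean u‖ₑ * B := by
      have e : (u : Euc d → ℂ) = (fun x => u x - mean u) + fun _ => mean u := by
        ext x; simp
      rw [e]
      refine (eLpNorm_add_le (hu2.1.sub aestronglyMeasurable_const) aestronglyMeasurable_const
        hp').trans ?_
      refine add_le_add (hK u hu1).2 ?_
      rw [eLpNorm_const_ofReal hp, hB]
    push_cast
    calc g + eLpNorm u (ENNReal.ofReal pm) (volume.restrict Ω)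
        ≤ g + (K * g + ‖mean u‖ₑ * B) := by gcongr
      _ ≤ g + (K * g + ‖mean u‖ₑ * B) + (B * g + ‖mean u‖ₑ + K * ‖mean u‖ₑ) := le_self_add
      _ = _ := by ring

end Spaces

end NonlocalOrlicz

/-! ### The main theorem -/

theorem mainTheorem5 {d : ℕ} (hd : 1 ≤ d) (Ω : Set (Euc d)) (hΩ_open : IsOpen Ω)
    (hΩ_conn : IsConnected Ω) (hΩ_bdd : Bornology.IsBounded Ω) (hΩ_lip : HasLipschitzBoundary Ω)
    (a : Euc d → ℝ) (ha : KernelConditions a)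
    (φ : ℝ → Euc d → Euc d → ℝ) (pm pp : ℝ) (hφ : PhiConditions Ω φ pm pp) :
    ∃ (Lam : Submodule ℂ (Coset Ω)) (L : Submodule ℂ (L1Loc Ω)),
      (Lam : Set (Coset Ω)) = cosetSpace Ω a φ ∧
      (L : Set (L1Loc Ω)) = fullSpace Ω a φ pm ∧
      -- the space of cosets is Banach
      IsBanachUnder Lam (cosetGauge Ω a φ) ∧
      -- each coset has a unique representative in `L_{p₋}(Ω)` with zero mean value
      (∀ U ∈ Lam, ∃! u : L1Loc Ω, coset u = U ∧
        MemLp u (ENNReal.ofReal pm) (volume.restrict Ω) ∧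
        mean u = 0) ∧
      -- the representation `u = u_⊥ + ⟨u⟩_Ω`
      (∀ u ∈ L, u = perp u + constFun Ω (mean u) ∧ mean (perp u) = 0 ∧
        coset u ∈ Lam ∧ coset (perp u) = coset u) ∧
      -- the direct sum decomposition
      (∃ T : L ≃ₗ[ℂ] (Lam × ℂ), ∀ u : L,
        ((T u).1 : Coset Ω) = coset (u : L1Loc Ω) ∧ (T u).2 = mean (u : L1Loc Ω)) ∧
      -- the equivalence of norms
      (∃ c₃ c₄ : ℝ≥0, 0 < c₃ ∧ 0 < c₄ ∧ ∀ u ∈ L,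
        (c₃ : ℝ≥0∞) * (orliczGauge Ω a φ (perp u) + ‖mean u‖ₑ) ≤
          fullNorm Ω a φ pm u ∧
        fullNorm Ω a φ pm u ≤
          (c₄ : ℝ≥0∞) *
            (orliczGauge Ω a φ (perp u) + ‖mean u‖ₑ)) := by
  have := neZero_restrict hΩ_open hΩ_conn.nonempty
  have := isFiniteMeasure_restrict hΩ_bdd
  have hp' : 1 ≤ ENNReal.ofReal pm := by simpa using hφ.one_lt.le
  refine ⟨cosetSubmodule ha hφ, fullSubmodule ha hφ, rfl, rfl,
    isBanachUnder_cosetGauge hΩ_open hΩ_conn hΩ_bdd ha hφ,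
    fun U hU => existsUnique_representative hΩ_open hΩ_conn hΩ_bdd ha hφ hU 0,
    fun u hu => ⟨(sub_add_cancel _ _).symm, mean_perp ?_, (mem_fullSubmodule.1 hu).1,
      coset_perp u⟩,
    exists_linearEquiv hΩ_open hΩ_conn hΩ_bdd ha hφ,
    exists_equivalent_norms hΩ_open hΩ_conn hΩ_bdd ha hφ⟩
  exact (mem_fullSubmodule.1 hu).2.integrable hp'
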